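/- **Theorem.** Consider simple undirected graphs $G=(V,E)$ with $n=|V|\ge 1$ vertices, $m=|E|$ edges, no isolated vertices, and average degree $d=2m/n$. Vertices carry distinct identifiers (natural numbers), and the set $V$ of identifiers is not known in advance. A randomized algorithm that knows $n$ accesses $G$ through the following queries, each of unit cost and answered with fresh independent randomness: $\mathbf{RandVert}()$ returns a uniformly random vertex; $\mathbf{RandNbr}(x)$ returns a uniformly random neighbor of $x$; $\mathbf{Degree}(x)$ returns $\deg(x)$; $\mathbf{Pair}(x,y)$ tells whether $\{x,y\}\in E$; $\mathbf{RandEdge}()$ returns a uniformly random edge. For $c\ge 1$, a $c$-approximation to $d$ is a number $\hat d$ with $d/c\le \hat d\le c\,d$. (a) There are constants $C>0$, $k\in\mathbb N$ and an algorithm, taking $n$ and $\varepsilon\in(0,1)$ as input, such that for every such graph $G$ on $n$ vertices, with probability $>0.99$ it outputs a $(1+\varepsilon)$-approximation to $d$ after at most $$C\,\varepsilon^{-2}(\log n)^k\,\min\bigl(d,\ (n/d)^{1/3}\bigr)$$ queries. In particular, with probability $>0.99$ it outputs a $(1+\varepsilon)$-approximation to $d$ after at most $C\,\varepsilon^{-2}(\log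 n)^k\, n^{1/4}$ queries. (b) For every constant $c\ge 1$ there are $\kappa>0$ and $n_0$ such that for all $n\ge n_0$ the following holds. If an algorithm, on every such graph on $n$ vertices, outputs with probability $>2/3$ a $c$-approximation to $d$ after at most $b$ queries, then $b\ge \kappa\, n^{1/4}$. This holds even if the set $V$ of identifiers is known to the algorithm, which then has to succeed only on the graphs with vertex set $V$. -/

import Mathlib

open scoped ENNReal

/-- Queries of the standard model together with random edge samples.  Vertices are named by
natural-number identifiers. -/
inductive Query where
  | randVert
  | randNbr (x : ℕ)
  | degree (x : ℕ)
  | pair (x y : ℕ)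
  | randEdge

/-- The type of answers to each query. -/
def Query.Answer : Query → Type
  | .randVert => ℕ
  | .randNbr _ => Option ℕ
  | .degree _ => ℕ
  | .pair _ _ => Bool
  | .randEdge => Sym2 ℕ

/-- What an algorithm does next: stop with an estimate, or make one query and continue from a
state that depends on the answer. -/
inductive QueryAction (S : Type) where
  | output (r : ℝ)
  | query (q : Query) (next : q.Answer → S)

/-- A randomized query algorithm.  Its memory is arbitrary, local computation and local coin
tosses are free, and it need not halt. -/
structure QueryAlgorithm where
  State : Type
  init : State
  step : State → PMF (QueryAction State)

/-- A (nonempty, finite, simple, undirected) input graph on the set `V` of vertex identifiers,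
without isolated vertices. -/
structure InputGraph (V : Finset ℕ) where
  nonempty : V.Nonempty
  graph : SimpleGraph V
  exists_adj : ∀ v, ∃ w, graph.Adj v w

noncomputable section

namespace InputGraph

variable {V : Finset ℕ} (G : InputGraph V)

open scoped Classical in
/-- The number `m` of edges. -/
def numEdges : ℕ := G.graph.edgeFinset.card

/-- The average degree `d = 2m/n`. -/
def avgDegree : ℝ := 2 * (G.numEdges : ℝ) / (V.card : ℝ)

open scoped Classical in
theorem edgeFinset_nonempty : G.graph.edgeFinset.Nonempty := by
  obtain ⟨v, hv⟩ := G.nonempty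
  obtain ⟨w, hw⟩ := G.exists_adj ⟨v, hv⟩
  exact ⟨s(⟨v, hv⟩, w), by simpa using hw⟩

open scoped Classical in
theorem neighborFinset_nonempty (v : V) : (G.graph.neighborFinset v).Nonempty := by
  obtain ⟨w, hw⟩ := G.exists_adj v
  exact ⟨w, by simpa using hw⟩

open scoped Classical in
/-- The distribution of the answer to a query.  Each query draws a fresh, independent answer.
Identifiers that do not name a vertex have no neighbors. -/
def oracle : (q : Query) → PMF q.Answer
  | .randVert => PMF.uniformOfFinset V G.nonempty
  | .randNbr x =>
      if hx : x ∈ V then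
        (PMF.uniformOfFinset (G.graph.neighborFinset ⟨x, hx⟩)
          (G.neighborFinset_nonempty ⟨x, hx⟩)).map fun y => some (y : ℕ)
      else PMF.pure none
  | .degree x => PMF.pure (if hx : x ∈ V then G.graph.degree ⟨x, hx⟩ else (0 : ℕ))
  | .pair x y =>
      PMF.pure (decide (∃ (hx : x ∈ V) (hy : y ∈ V), G.graph.Adj ⟨x, hx⟩ ⟨y, hy⟩))
  | .randEdge =>
      (PMF.uniformOfFinset G.graph.edgeFinset G.edgeFinset_nonempty).map
        (Sym2.map ((↑) : V → ℕ))

end InputGraph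

namespace QueryAlgorithm

/-- The outcome of running an algorithm from state `s` for at most `b` queries: `some r` if it
outputs `r` after making at most `b` queries, and `none` if it wants to make more queries. -/
def run (A : QueryAlgorithm) (O : (q : Query) → PMF q.Answer) :
    ℕ → A.State → PMF (Option ℝ)
  | 0, s => (A.step s).bind fun
      | .output r => PMF.pure (some r)
      | .query _ _ => PMF.pure none
  | b + 1, s => (A.step s).bind fun
      | .output r => PMF.pure (some r)
      | .query q next => (O q).bind fun a => A.run O b (next a)

/-- The probability that, on the input graph `G`, the algorithm makes at most `b` queries and
outputs a value in `[d / c, c * d]`, where `d` is the average degree of `G`. -/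
def approxProb (A : QueryAlgorithm) {V : Finset ℕ} (G : InputGraph V) (b : ℕ) (c : ℝ) : ℝ≥0∞ :=
  (A.run G.oracle b A.init).toOuterMeasure
    {o | ∃ r, o = some r ∧ G.avgDegree / c ≤ r ∧ r ≤ c * G.avgDegree}

end QueryAlgorithm

end

/-! Upper bound. The origin of a randomly oriented random edge (a dart) is drawn proportionally to
degree, so the mean of its inverse degree is `1/d`, and about `d` samples determine `d`. For larger
`d`, call vertices of degree at most `τ` low and the others high. If darts with low origin make up a
constant fraction of all darts, their frequency, compared with the mean low degree of a random
vertex, gives `d` from about `τ/d` samples. Otherwise darts with two high ends make up a constant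
fraction. They can also be counted through pairs of independent dart origins: the event that both
are high and adjacent, reweighted by the inverse degrees and scaled by `τ²`, has mean of order
`τ²/(nd)`, so about `nd/τ²` samples suffice. By `InputGraph.two_mul_numEdges_le` one of the two
cases occurs. With `τ² ≈ nd/B`, both cost `O(B)` samples once `B³ d ≥ n`
(`InputGraph.exists_trial`).

Since `d` is unknown, budgets are doubled. A trial answers only if both of its sums reach a
threshold, so it rarely answers wrongly even when its budget is too small
(`Prog.expect_testFails_le`), and the first answer can be trusted
(`Prog.one_le_expect_run_firstSome`).

Lower bound. Join a hub to all vertices and plant `t` random disjoint cliques of size `k²`, where `k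
≈ n^(1/4)` and `t` is `k` or `C k`. The clique edges dominate, so for large `C` the two average
degrees differ by a factor above `c²`. Up to errors of order `1/k`, an unseen vertex is low, a
random edge lies inside a clique on two unseen vertices, and a random neighbor of a clique vertex is
unseen. Hence the answers can be imitated by `SeenState.ideal`, which does not involve `t`.

The delicate point is the birthday paradox: among `b` random edges two share a clique with
probability about `b²/t`, which alone would only give `b ≳ √k`. Such a coincidence stays invisible
until a pair query tests it. So `hiddenAvg` lets every clique handle denote an independent uniform
clique, and an error `1/t` is paid only when a pair query compares two handles
(`hiddenAvg_le_add_inv`). Each query then costs `O(1/k)` (`SeenState.ideal_le`) and a run costs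
`O(b/k)` (`SeenState.idealRun_le`). If `b` is a small multiple of `k`, a single output distribution
would have to be accurate for two incompatible average degrees. -/

namespace PMF

/-! ### Expectations of nonnegative functions. -/

variable {α β : Type*}

/-- The expectation of a nonnegative function under a probability mass function. -/
noncomputable def expect (p : PMF α) (f : α → ℝ≥0∞) : ℝ≥0∞ := ∑' a, p a * f a

theorem expect_pure (a : α) (f : α → ℝ≥0∞) : (PMF.pure a).expect f = f a := by
  classical
  rw [expect, tsum_eq_single a]
  · simp
  · intro b hb
    simp [PMF.pure_apply, hb]

theorem expect_bind (p : PMF α) (k : α → PMF β) (f : β → ℝ≥0∞) :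
    (p.bind k).expect f = p.expect fun a => (k a).expect f := by
  simp only [expect, PMF.bind_apply, ← ENNReal.tsum_mul_right, ← ENNReal.tsum_mul_left]
  rw [ENNReal.tsum_comm]
  simp only [mul_assoc]

theorem expect_map (p : PMF α) (g : α → β) (f : β → ℝ≥0∞) :
    (p.map g).expect f = p.expect fun a => f (g a) := by
  rw [← PMF.bind_pure_comp, expect_bind]
  simp only [Function.comp_apply, expect_pure]

theorem expect_mono (p : PMF α) {f g : α → ℝ≥0∞} (h : ∀ a, f a ≤ g a) :
    p.expect f ≤ p.expect g :=
  ENNReal.tsum_le_tsum fun a => mul_le_mul_right (h a) _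

theorem expect_const (p : PMF α) (c : ℝ≥0∞) : (p.expect fun _ => c) = c := by
  rw [expect, ENNReal.tsum_mul_right, p.tsum_coe, one_mul]

theorem expect_add (p : PMF α) (f g : α → ℝ≥0∞) :
    (p.expect fun a => f a + g a) = p.expect f + p.expect g := by
  simp only [expect, mul_add, ENNReal.tsum_add]

theorem expect_const_mul (p : PMF α) (c : ℝ≥0∞) (f : α → ℝ≥0∞) :
    (p.expect fun a => c * f a) = c * p.expect f := by
  simp only [expect, ← ENNReal.tsum_mul_left, mul_left_comm]

theorem expect_sum {ι : Type*} (p : PMF α) (s : Finset ι) (f : ι → α → ℝ≥0∞) :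
    (p.expect fun a => ∑ i ∈ s, f i a) = ∑ i ∈ s, p.expect (f i) := by
  simp only [expect, Finset.mul_sum]
  exact Summable.tsum_finsetSum fun _ _ => ENNReal.summable

theorem expect_le_one (p : PMF α) {f : α → ℝ≥0∞} (h : ∀ a, f a ≤ 1) : p.expect f ≤ 1 :=
  (p.expect_mono h).trans (p.expect_const 1).le

theorem expect_uniformOfFinset (s : Finset α) (hs : s.Nonempty) (f : α → ℝ≥0∞) :
    (uniformOfFinset s hs).expect f = (s.card : ℝ≥0∞)⁻¹ * ∑ a ∈ s, f a := by
  classical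
  rw [expect, tsum_eq_sum (s := s), Finset.mul_sum]
  · exact Finset.sum_congr rfl fun a ha => by rw [uniformOfFinset_apply_of_mem hs ha]
  · intro a ha
    rw [uniformOfFinset_apply_of_notMem hs ha, zero_mul]

open scoped Classical in
theorem toOuterMeasure_eq_expect (p : PMF α) (S : Set α) :
    p.toOuterMeasure S = p.expect fun a => if a ∈ S then 1 else 0 := by
  rw [toOuterMeasure_apply, expect]
  refine tsum_congr fun a => ?_
  by_cases h : a ∈ S <;> simp [h]

end PMF

/-! ### Query programs, their cost, and their execution under a budget. -/

/-- Randomized query programs with fair local coins. -/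
inductive Prog (α : Type) : Type where
  | ret (a : α)
  | query (q : Query) (next : q.Answer → Prog α)
  | coin (next : Bool → Prog α)

noncomputable section

namespace Prog

variable {α β : Type}

/-- Sequential composition. -/
def bind : Prog α → (α → Prog β) → Prog β
  | ret a, k => k a
  | query q next, k => query q fun x => (next x).bind k
  | coin next, k => coin fun x => (next x).bind k

/-- Postprocessing of the result. -/
def map (f : α → β) (p : Prog α) : Prog β := p.bind fun a => ret (f a)

/-- A fair coin. -/
def fairCoin : PMF Bool := PMF.uniformOfFinset Finset.univ Finset.univ_nonempty

/-- The distribution of the result. -/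
def eval (O : (q : Query) → PMF q.Answer) : Prog α → PMF α
  | ret a => PMF.pure a
  | query q next => (O q).bind fun x => (next x).eval O
  | coin next => fairCoin.bind fun x => (next x).eval O

/-- `p.CostLE c` says that the program `p` never makes more than `c` queries. -/
def CostLE : Prog α → ℕ → Prop
  | ret _, _ => True
  | query _ _, 0 => False
  | query _ next, c + 1 => ∀ x, (next x).CostLE c
  | coin next, c => ∀ x, (next x).CostLE c

theorem expect_fairCoin (f : Bool → ℝ≥0∞) :
    fairCoin.expect f = 2⁻¹ * (f true + f false) := by
  rw [fairCoin, PMF.expect_uniformOfFinset]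
  simp

theorem eval_bind (O : (q : Query) → PMF q.Answer) (p : Prog α) (k : α → Prog β) :
    (p.bind k).eval O = (p.eval O).bind fun a => (k a).eval O := by
  induction p with
  | ret a => simp [bind, eval]
  | query q next ih => simp only [bind, eval, PMF.bind_bind, ih]
  | coin next ih => simp only [bind, eval, PMF.bind_bind, ih]

theorem expect_eval_bind (O : (q : Query) → PMF q.Answer) (p : Prog α) (k : α → Prog β)
    (f : β → ℝ≥0∞) :
    ((p.bind k).eval O).expect f = (p.eval O).expect fun a => ((k a).eval O).expect f := by
  rw [eval_bind, PMF.expect_bind]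

theorem expect_eval_map (O : (q : Query) → PMF q.Answer) (p : Prog α) (g : α → β)
    (f : β → ℝ≥0∞) :
    ((p.map g).eval O).expect f = (p.eval O).expect fun a => f (g a) := by
  simp only [map, expect_eval_bind, eval, PMF.expect_pure]

theorem CostLE.mono {p : Prog α} : ∀ {c c' : ℕ}, p.CostLE c → c ≤ c' → p.CostLE c' := by
  induction p with
  | ret a => intros; trivial
  | query q next ih =>
    rintro (_ | c) (_ | c') h hc
    · exact h
    · exact h.elim
    · omega
    · exact fun x => ih x (h x) (by omega)
  | coin next ih => exact fun h hc x => ih x (h x) hc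

theorem CostLE.bind {p : Prog α} {k : α → Prog β} {c' : ℕ} (hk : ∀ a, (k a).CostLE c') :
    ∀ {c : ℕ}, p.CostLE c → (p.bind k).CostLE (c + c') := by
  induction p with
  | ret a => exact fun _ => (hk a).mono (by omega)
  | query q next ih =>
    rintro (_ | c) h
    · exact h.elim
    · rw [Nat.add_right_comm]
      exact fun x => ih x (h x)
  | coin next ih => exact fun h x => ih x (h x)

theorem CostLE.map {p : Prog α} {c : ℕ} (h : p.CostLE c) (f : α → β) : (p.map f).CostLE c :=
  h.bind (c' := 0) fun a => show (ret (f a)).CostLE 0 from trivial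

/-- One step of a program, in which the coins up to the next query are tossed. -/
def step : Prog ℝ → PMF (QueryAction (Prog ℝ))
  | ret r => PMF.pure (.output r)
  | query q next => PMF.pure (.query q next)
  | coin next => fairCoin.bind fun x => (next x).step

/-- The query algorithm that executes a program. -/
def toAlgorithm (p : Prog ℝ) : QueryAlgorithm where
  State := Prog ℝ
  init := p
  step := step

variable (O : (q : Query) → PMF q.Answer) (p₀ : Prog ℝ)

theorem run_ret (b : ℕ) (r : ℝ) :
    p₀.toAlgorithm.run O b (ret r) = PMF.pure (some r) := by
  cases b <;> simp only [QueryAlgorithm.run, toAlgorithm, step, PMF.pure_bind]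

theorem run_query_zero (q : Query) (next : q.Answer → Prog ℝ) :
    p₀.toAlgorithm.run O 0 (query q next) = PMF.pure none := by
  simp only [QueryAlgorithm.run, toAlgorithm, step, PMF.pure_bind]

theorem run_query_succ (b : ℕ) (q : Query) (next : q.Answer → Prog ℝ) :
    p₀.toAlgorithm.run O (b + 1) (query q next) =
      (O q).bind fun x => p₀.toAlgorithm.run O b (next x) := by
  simp only [QueryAlgorithm.run, toAlgorithm, step, PMF.pure_bind]

theorem run_coin (b : ℕ) (next : Bool → Prog ℝ) :
    p₀.toAlgorithm.run O b (coin next) =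
      fairCoin.bind fun x => p₀.toAlgorithm.run O b (next x) := by
  cases b <;> simp only [QueryAlgorithm.run, toAlgorithm, step, PMF.bind_bind]

/-- A larger budget only replaces the outcome `none`, which `f` counts as zero. -/
theorem expect_run_mono {f : Option ℝ → ℝ≥0∞} (hf : f none = 0) (p : Prog ℝ) :
    ∀ {b b' : ℕ}, b ≤ b' →
      (p₀.toAlgorithm.run O b p).expect f ≤ (p₀.toAlgorithm.run O b' p).expect f := by
  induction p with
  | ret a => intros; simp only [run_ret]; exact le_rfl
  | query q next ih =>
    rintro (_ | b) (_ | b') h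
    · exact le_rfl
    · rw [run_query_zero, PMF.expect_pure, hf]; exact zero_le
    · omega
    · rw [run_query_succ, run_query_succ, PMF.expect_bind, PMF.expect_bind]
      exact PMF.expect_mono _ fun x => ih x (by omega)
  | coin next ih =>
    intro b b' h
    rw [run_coin, run_coin, PMF.expect_bind, PMF.expect_bind]
    exact PMF.expect_mono _ fun x => ih x h

/-- The first stage uses at most `c` queries, so at least `b` remain for the continuation. This is
an inequality because a cheap first stage leaves more. -/
theorem expect_run_bind {f : Option ℝ → ℝ≥0∞} (hf : f none = 0) (b : ℕ) (p : Prog α)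
    (k : α → Prog ℝ) : ∀ {c : ℕ}, p.CostLE c →
      ((p.eval O).expect fun a => (p₀.toAlgorithm.run O b (k a)).expect f) ≤
        (p₀.toAlgorithm.run O (c + b) (p.bind k)).expect f := by
  induction p with
  | ret a =>
    intro c _
    rw [eval, PMF.expect_pure]
    exact expect_run_mono O p₀ hf _ (by omega)
  | query q next ih =>
    rintro (_ | c) h
    · exact h.elim
    · rw [Nat.add_right_comm, bind, run_query_succ, eval, PMF.expect_bind, PMF.expect_bind]
      exact PMF.expect_mono _ fun x => ih x (h x)
  | coin next ih =>
    intro c h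
    rw [bind, run_coin, eval, PMF.expect_bind, PMF.expect_bind]
    exact PMF.expect_mono _ fun x => ih x (h x)

/-- Runs trials until one of them returns an estimate. -/
def firstSome {ι : Type} (t : ι → Prog (Option ℝ)) : List ι → Prog ℝ
  | [] => ret 0
  | i :: l => (t i).bind fun
      | some r => ret r
      | none => firstSome t l

open scoped Classical in
/-- If no trial is likely to return a bad estimate, and some trial is likely to return a good one,
then a good estimate is likely to be found by the time that trial is over. -/
theorem one_le_expect_run_firstSome {ι : Type} (t : ι → Prog (Option ℝ)) (cost : ι → ℕ)
    (S : Set ℝ) (δ : ℝ≥0∞) (l₂ : List ι) (i₀ : ι)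
    (hacc : ((t i₀).eval O).expect (fun o => if ¬ ∃ r ∈ S, o = some r then 1 else 0) ≤ δ) :
    ∀ l₁ : List ι, i₀ ∈ l₁ → (∀ i ∈ l₁, (t i).CostLE (cost i)) →
      (∀ i ∈ l₁, ((t i).eval O).expect (fun o => if ∃ r, r ∉ S ∧ o = some r then 1 else 0) ≤ δ) →
      1 ≤ (p₀.toAlgorithm.run O (l₁.map cost).sum (firstSome t (l₁ ++ l₂))).expect
          (fun o => if ∃ r ∈ S, o = some r then 1 else 0) + l₁.length * δ := by
  intro l₁
  induction l₁ with
  | nil => intro h; simp at h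
  | cons i l ih =>
    intro hmem hcost hbad
    set f : Option ℝ → ℝ≥0∞ := fun o => if ∃ r ∈ S, o = some r then 1 else 0 with hf
    have hrun := expect_run_bind O p₀ (f := f) (by simp [hf]) (l.map cost).sum (t i)
      (fun | some r => ret r | none => firstSome t (l ++ l₂)) (hcost i (by simp))
    simp only [List.map_cons, List.sum_cons, List.cons_append, firstSome, List.length_cons]
    by_cases hi : i = i₀
    · subst hi
      have key : (1 : ℝ≥0∞) ≤ ((t i).eval O).expect (fun a => (p₀.toAlgorithm.run O (l.map cost).sum
          (match a with | some r => ret r | none => firstSome t (l ++ l₂))).expect f) + δ := by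
        refine le_trans ?_ (add_le_add le_rfl hacc)
        rw [← PMF.expect_add]
        refine le_trans (PMF.expect_const ((t i).eval O) 1).ge (PMF.expect_mono _ ?_)
        rintro (_ | r)
        · simp
        · by_cases hr : r ∈ S
          · simp [run_ret, PMF.expect_pure, hf, hr]
          · simp [hr]
      refine key.trans (add_le_add hrun ?_)
      push_cast
      rw [add_mul, one_mul]
      exact le_add_self
    · have hmem' : i₀ ∈ l := by
        rcases List.mem_cons.1 hmem with h | h
        · exact absurd h.symm hi
        · exact h
      have ih' := ih hmem' (fun j hj => hcost j (List.mem_cons_of_mem _ hj))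
        (fun j hj => hbad j (List.mem_cons_of_mem _ hj))
      have key : (1 : ℝ≥0∞) ≤ ((t i).eval O).expect (fun a => (p₀.toAlgorithm.run O (l.map cost).sum
          (match a with | some r => ret r | none => firstSome t (l ++ l₂))).expect f) +
          (l.length * δ + δ) := by
        refine le_trans ?_ (add_le_add le_rfl (add_le_add le_rfl (hbad i (by simp))))
        rw [← PMF.expect_const ((t i).eval O) (l.length * δ)]
        rw [← PMF.expect_add, ← PMF.expect_add]
        refine le_trans (PMF.expect_const ((t i).eval O) 1).ge (PMF.expect_mono _ ?_)
        rintro (_ | r)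
        · refine ih'.trans ?_
          rw [← add_assoc]
          exact le_self_add
        · by_cases hr : r ∈ S
          · simp [run_ret, PMF.expect_pure, hf, hr]
          · simp only [Option.some.injEq, exists_eq_right', hr, not_false_eq_true, if_true]
            rw [← add_assoc]
            exact le_add_self
      refine key.trans (add_le_add hrun ?_)
      push_cast
      rw [add_mul, one_mul]

/-- The sum of the results of `N` independent executions. -/
def sumOf (p : Prog NNReal) : ℕ → Prog NNReal
  | 0 => ret 0
  | N + 1 => p.bind fun x => (sumOf p N).map fun y => x + y

theorem CostLE.sumOf {p : Prog NNReal} {c : ℕ} (h : p.CostLE c) :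
    ∀ N : ℕ, (p.sumOf N).CostLE (N * c)
  | 0 => trivial
  | N + 1 => by
    rw [Nat.succ_mul, Nat.add_comm (N * c)]
    exact h.bind fun x => (h.sumOf N).map _

end Prog


/-! ### Concentration of sums and the threshold test. -/

namespace Prog

variable (O : (q : Query) → PMF q.Answer)

theorem expect_sumOf {p : Prog NNReal} {μ : NNReal}
    (hμ : (p.eval O).expect (fun x => (x : ℝ≥0∞)) = μ) (N : ℕ) :
    ((p.sumOf N).eval O).expect (fun x => (x : ℝ≥0∞)) = ((N * μ : NNReal) : ℝ≥0∞) := by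
  induction N with
  | zero => simp [sumOf, eval, PMF.expect_pure]
  | succ N ih =>
    simp only [sumOf, expect_eval_bind, expect_eval_map, ENNReal.coe_add, PMF.expect_add,
      PMF.expect_const, ih, hμ]
    push_cast
    ring

/-- A bound `N μ` on the variance, written without subtraction: variances of independent samples
add, and each is at most the second moment. -/
theorem expect_sumOf_sq {p : Prog NNReal} {μ : NNReal}
    (hμ : (p.eval O).expect (fun x => (x : ℝ≥0∞)) = μ)
    (hsq : (p.eval O).expect (fun x => (x : ℝ≥0∞) ^ 2) ≤ μ) (N : ℕ) :
    ((p.sumOf N).eval O).expect (fun x => (x : ℝ≥0∞) ^ 2) ≤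
      ((N * μ + (N * μ) ^ 2 : NNReal) : ℝ≥0∞) := by
  induction N with
  | zero => simp [sumOf, eval, PMF.expect_pure]
  | succ N ih =>
    have hexp : ∀ x y : NNReal, ((x + y : NNReal) : ℝ≥0∞) ^ 2 =
        (x : ℝ≥0∞) ^ 2 + (2 * x : ℝ≥0∞) * y + (y : ℝ≥0∞) ^ 2 := by
      intro x y; push_cast; ring
    have hcomm : (fun a : NNReal => 2 * (a : ℝ≥0∞) * ((N * μ : NNReal) : ℝ≥0∞)) =
        fun a : NNReal => (2 * ((N * μ : NNReal) : ℝ≥0∞)) * (a : ℝ≥0∞) := by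
      funext a; ring
    simp only [sumOf, expect_eval_bind, expect_eval_map, hexp, PMF.expect_add,
      PMF.expect_const_mul, PMF.expect_const, expect_sumOf O hμ, hcomm, hμ]
    refine (add_le_add (add_le_add hsq le_rfl) ih).trans ?_
    rw [← ENNReal.coe_ofNat, ← ENNReal.coe_mul, ← ENNReal.coe_mul, ← ENNReal.coe_add,
      ← ENNReal.coe_add, ENNReal.coe_le_coe, ← NNReal.coe_le_coe]
    push_cast
    nlinarith [sq_nonneg (μ : ℝ)]

open scoped Classical in
/-- Chebyshev's inequality for the sum of independent samples whose second moment is at most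
their mean. -/
theorem chebyshev_sumOf {p : Prog NNReal} {μ : NNReal}
    (hμ : (p.eval O).expect (fun x => (x : ℝ≥0∞)) = μ)
    (hsq : (p.eval O).expect (fun x => (x : ℝ≥0∞) ^ 2) ≤ μ) (N : ℕ) {θ δ : ℝ}
    (hθ : 0 < θ) (hδ : N * μ ≤ δ * θ ^ 2) (P : NNReal → Prop)
    (hP : ∀ x, P x → θ ≤ |(x : ℝ) - N * μ|) :
    ((p.sumOf N).eval O).expect (fun x => if P x then 1 else 0) ≤ ENNReal.ofReal δ := by
  set q := (p.sumOf N).eval O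
  lift θ to NNReal using hθ.le
  have hδ0 : 0 ≤ δ := by
    by_contra h
    push Not at h
    have : 0 ≤ (N : ℝ) * μ := by positivity
    nlinarith [pow_pos hθ 2]
  lift δ to NNReal using hδ0
  set a : NNReal := N * μ with ha
  -- This is `θ² 1_P ≤ (x - a)²` with the cross term moved to the left, so that it makes sense for
  -- extended nonnegative values.
  have hpt : ∀ x : NNReal, ((θ ^ 2 : NNReal) : ℝ≥0∞) * (if P x then 1 else 0) +
      ((2 * a : NNReal) : ℝ≥0∞) * x ≤ (x : ℝ≥0∞) ^ 2 + ((a ^ 2 : NNReal) : ℝ≥0∞) := by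
    intro x
    split_ifs with h
    · rw [mul_one, ← ENNReal.coe_mul, ← ENNReal.coe_add, ← ENNReal.coe_pow, ← ENNReal.coe_add,
        ENNReal.coe_le_coe, ← NNReal.coe_le_coe]
      have h1 := hP x h
      have h2 : (θ : ℝ) ^ 2 ≤ ((x : ℝ) - N * μ) ^ 2 := by
        rw [← sq_abs ((x : ℝ) - N * μ)]
        exact pow_le_pow_left₀ θ.coe_nonneg h1 2
      simp only [ha]
      push_cast
      nlinarith
    · rw [mul_zero, zero_add, ← ENNReal.coe_mul, ← ENNReal.coe_pow, ← ENNReal.coe_add,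
        ENNReal.coe_le_coe, ← NNReal.coe_le_coe]
      push_cast
      nlinarith [sq_nonneg ((x : ℝ) - a)]
  have hE := PMF.expect_mono q hpt
  simp only [PMF.expect_add, PMF.expect_const_mul, PMF.expect_const] at hE
  rw [show q.expect (fun x => (x : ℝ≥0∞)) = _ from expect_sumOf O hμ N, ← ha] at hE
  have hE2 := hE.trans (add_le_add (expect_sumOf_sq O hμ hsq N) le_rfl)
  rw [← ha] at hE2
  set e := q.expect (fun x => if P x then (1 : ℝ≥0∞) else 0)
  have he : e ≤ 1 := PMF.expect_le_one _ fun x => by split_ifs <;> simp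
  lift e to NNReal using (he.trans_lt ENNReal.one_lt_top).ne with e'
  rw [← ENNReal.coe_mul, ← ENNReal.coe_mul, ← ENNReal.coe_add, ← ENNReal.coe_add,
    ENNReal.coe_le_coe, ← NNReal.coe_le_coe] at hE2
  rw [ENNReal.ofReal_coe_nnreal, ENNReal.coe_le_coe, ← NNReal.coe_le_coe]
  have haR : (a : ℝ) = N * μ := by simp [ha]
  push_cast at hE2
  rw [← haR] at hδ
  have h3 : (θ : ℝ) ^ 2 * e' ≤ θ ^ 2 * δ := by nlinarith
  exact le_of_mul_le_mul_left h3 (pow_pos hθ 2)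

/-- The failure event of a threshold test on a sum `x` with mean `a`: the test accepts and the sum
is inaccurate, or the test should accept and does not. -/
def TestFails (η T a : ℝ) (x : NNReal) : Prop :=
  (T ≤ x ∧ η * a < |(x : ℝ) - a|) ∨ (2 * T ≤ a ∧ (x : ℝ) < T)

-- If the mean is at least `T / 2`, either failure is a relative deviation of at least `η`. If it is
-- smaller, only acceptance can fail, and that is a deviation of at least `T / 2`. Chebyshev gives
-- the same bound in both cases, so nothing need be known about the mean.
open scoped Classical in
theorem expect_testFails_le {p : Prog NNReal} {μ : NNReal}
    (hμ : (p.eval O).expect (fun x => (x : ℝ≥0∞)) = μ)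
    (hsq : (p.eval O).expect (fun x => (x : ℝ≥0∞) ^ 2) ≤ μ) (N : ℕ) {η T : ℝ}
    (hη : 0 < η) (hη' : η ≤ 1 / 2) (hT : 0 < T) :
    ((p.sumOf N).eval O).expect (fun x => if TestFails η T (N * μ) x then 1 else 0) ≤
      ENNReal.ofReal (2 / (η ^ 2 * T)) := by
  have ha0 : (0 : ℝ) ≤ N * μ := by positivity
  rcases le_or_gt (T / 2) (N * μ) with h | h
  · have ha : 0 < (N : ℝ) * μ := by linarith
    refine chebyshev_sumOf O hμ hsq N (θ := η * (N * μ)) (by positivity) ?_ _ ?_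
    · rw [div_mul_eq_mul_div, le_div_iff₀ (by positivity)]
      have : 0 ≤ η ^ 2 * ((N : ℝ) * μ) * (2 * (N * μ) - T) := by
        apply mul_nonneg (by positivity); linarith
      nlinarith
    · rintro x (⟨-, h2⟩ | ⟨h1, h2⟩)
      -- In the other failure below, `x < T ≤ a / 2` is a deviation of at least `a / 2 ≥ η a`; here
      -- `η ≤ 1 / 2` is used.
      · exact h2.le
      · rw [abs_sub_comm]
        refine le_trans ?_ (le_abs_self _)
        nlinarith
  · refine chebyshev_sumOf O hμ hsq N (θ := T / 2) (by positivity) ?_ _ ?_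
    · rw [div_mul_eq_mul_div, le_div_iff₀ (by positivity)]
      have h4 : η ^ 2 ≤ 1 := by nlinarith
      have h5 : N * μ * (η ^ 2 * T) ≤ (T / 2) * (1 * T) := by gcongr
      linarith
    · rintro x (⟨h1, -⟩ | ⟨h1, h2⟩)
      · refine le_trans ?_ (le_abs_self _)
        linarith
      · linarith

/-- Estimates two means from `N` samples each, and gives up unless both sums reach the
threshold `T`. -/
def trial (p q : Prog NNReal) (N : ℕ) (T : ℝ) (out : ℝ → ℝ → ℝ) : Prog (Option ℝ) :=
  open scoped Classical in
  (p.sumOf N).bind fun x => (q.sumOf N).map fun y : NNReal =>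
    if T ≤ (x : ℝ) ∧ T ≤ (y : ℝ) then some (out x y) else none

theorem CostLE.trial {p q : Prog NNReal} {c c' : ℕ} (hp : p.CostLE c) (hq : q.CostLE c') (N : ℕ)
    (T : ℝ) (out : ℝ → ℝ → ℝ) : (p.trial q N T out).CostLE (N * (c + c')) := by
  rw [mul_add]
  exact (hp.sumOf N).bind fun x => (hq.sumOf N).map _

-- Union bound over the threshold tests of the two sums.
open scoped Classical in
theorem expect_trial_le {p q : Prog NNReal} {μ ν : NNReal}
    (hμ : (p.eval O).expect (fun x => (x : ℝ≥0∞)) = μ)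
    (hμsq : (p.eval O).expect (fun x => (x : ℝ≥0∞) ^ 2) ≤ μ)
    (hν : (q.eval O).expect (fun x => (x : ℝ≥0∞)) = ν)
    (hνsq : (q.eval O).expect (fun x => (x : ℝ≥0∞) ^ 2) ≤ ν)
    (N : ℕ) {η T : ℝ} (hη : 0 < η) (hη' : η ≤ 1 / 2) (hT : 0 < T) (out : ℝ → ℝ → ℝ)
    (P : Option ℝ → Prop)
    (hP : ∀ x y : NNReal, P (if T ≤ (x : ℝ) ∧ T ≤ (y : ℝ) then some (out x y) else none) →
      TestFails η T (N * μ) x ∨ TestFails η T (N * ν) y) :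
    ((p.trial q N T out).eval O).expect (fun o => if P o then 1 else 0) ≤
      ENNReal.ofReal (4 / (η ^ 2 * T)) := by
  simp only [trial, expect_eval_bind, expect_eval_map]
  have h4 : ENNReal.ofReal (4 / (η ^ 2 * T)) =
      ENNReal.ofReal (2 / (η ^ 2 * T)) + ENNReal.ofReal (2 / (η ^ 2 * T)) := by
    rw [← ENNReal.ofReal_add (by positivity) (by positivity)]
    ring_nf
  rw [h4]
  refine le_trans ?_ (add_le_add (expect_testFails_le O hμ hμsq N hη hη' hT)
    (expect_testFails_le O hν hνsq N hη hη' hT))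
  rw [← PMF.expect_const ((p.sumOf N).eval O) (((q.sumOf N).eval O).expect _), ← PMF.expect_add]
  refine PMF.expect_mono _ fun x => ?_
  rw [← PMF.expect_const ((q.sumOf N).eval O) (ite _ _ _), ← PMF.expect_add]
  refine PMF.expect_mono _ fun y => ?_
  by_cases hxy : P (if T ≤ (x : ℝ) ∧ T ≤ (y : ℝ) then some (out x y) else none)
  · rw [if_pos hxy]
    rcases hP x y hxy with h | h <;> simp [h]
  · rw [if_neg hxy]
    exact zero_le

end Prog

/-! ### Sampling vertices, darts and pairs of darts. -/

namespace Prog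

/-- The degree of a random vertex. -/
def vertexDegree : Prog ℕ := query .randVert fun v => query (.degree v) fun d => ret d

/-- A random edge with a random orientation, together with the degrees of its endpoints. -/
def dart : Prog ((ℕ × ℕ) × (ℕ × ℕ)) :=
  query .randEdge fun e => coin fun b =>
    let a : ℕ × ℕ := if b then Quot.out (e : Sym2 ℕ) else (Quot.out (e : Sym2 ℕ)).swap
    query (.degree a.1) fun d₁ => query (.degree a.2) fun d₂ => ret (a, (d₁, d₂))

/-- The degrees of the origins of two random darts, and whether these origins are adjacent. -/
def dartPair : Prog ((ℕ × ℕ) × Bool) :=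
  dart.bind fun x => dart.bind fun y =>
    query (.pair x.1.1 y.1.1) fun b => ret ((x.2.1, y.2.1), b)

theorem costLE_vertexDegree : vertexDegree.CostLE 2 := fun _ _ => trivial

theorem costLE_dart : dart.CostLE 3 := fun _ _ _ _ => trivial

theorem costLE_dartPair : dartPair.CostLE 7 :=
  costLE_dart.bind (c' := 4) fun x => costLE_dart.bind (c' := 1) fun y =>
    show CostLE (query (.pair x.1.1 y.1.1) fun b => ret ((x.2.1, y.2.1), b)) 1 from fun _ => trivial

end Prog

namespace InputGraph

variable {V : Finset ℕ} (G : InputGraph V)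

open scoped Classical in
/-- The degree of a vertex. -/
def deg (v : V) : ℕ := G.graph.degree v

theorem deg_pos (v : V) : 0 < G.deg v := by
  classical
  rw [deg, SimpleGraph.degree_pos_iff_exists_adj]
  exact G.exists_adj v

theorem sum_deg : ∑ v, G.deg v = 2 * G.numEdges := by
  classical
  exact G.graph.sum_degrees_eq_twice_card_edges

open scoped Classical in
/-- The sum of a function over all ordered pairs of adjacent vertices. -/
def dartSum {M : Type*} [AddCommMonoid M] (f : V → V → M) : M :=
  ∑ u, ∑ v, if G.graph.Adj u v then f u v else 0

theorem dartSum_fst {M : Type*} [AddCommMonoid M] (f : V → M) :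
    (G.dartSum fun u _ => f u) = ∑ u, G.deg u • f u := by
  classical
  refine Finset.sum_congr rfl fun u _ => ?_
  rw [← Finset.sum_filter, Finset.sum_const, deg, ← G.graph.card_neighborFinset_eq_degree]
  congr 2
  ext v
  simp

-- Whichever representative `Quot.out` picks, it and its swap are the two orientations of the edge;
-- hence a fair coin turns a random edge into a uniform dart.
open scoped Classical in
theorem sum_edgeFinset_eq_dartSum (F : ℕ × ℕ → ℝ≥0∞) :
    ∑ e ∈ G.graph.edgeFinset,
      (F (Quot.out (e.map ((↑) : V → ℕ))) + F (Quot.out (e.map ((↑) : V → ℕ))).swap) =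
    G.dartSum fun u v => F (u, v) := by
  have h1 : (G.dartSum fun u v => F ((u : ℕ), (v : ℕ))) =
      ∑ d : G.graph.Dart, F (d.fst, d.snd) := by
    rw [dartSum, ← Fintype.sum_prod_type'
      (f := fun u v : V => if G.graph.Adj u v then F (u, v) else 0), ← Finset.sum_filter]
    symm
    refine Finset.sum_bij (fun d _ => d.toProd) ?_ ?_ ?_ ?_
    · intro d _; simp [d.adj]
    · intro a _ b _ h; exact SimpleGraph.Dart.ext _ _ h
    · intro b hb; exact ⟨⟨b, by simpa using hb⟩, by simp, rfl⟩
    · intro d _; rfl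
  rw [h1, ← Finset.sum_fiberwise_of_maps_to (t := G.graph.edgeFinset)
    (g := fun d : G.graph.Dart => d.edge) (fun d _ => by simp)]
  refine Finset.sum_congr rfl fun e he => ?_
  induction e with
  | _ u v =>
    have huv : G.graph.Adj u v := by simpa using he
    have hfib := (⟨(u, v), huv⟩ : G.graph.Dart).edge_fiber
    have hedge : (⟨(u, v), huv⟩ : G.graph.Dart).edge = s(u, v) := rfl
    rw [hedge] at hfib
    rw [hfib, Finset.sum_pair (SimpleGraph.Dart.symm_ne _).symm]
    simp only [Sym2.map_mk, SimpleGraph.Dart.symm_mk, Prod.swap_prod_mk]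
    have hout : s((Quot.out s((u : ℕ), (v : ℕ))).1, (Quot.out s((u : ℕ), (v : ℕ))).2) =
        s((u : ℕ), (v : ℕ)) := Quot.out_eq _
    rcases Sym2.eq_iff.1 hout with ⟨a, b⟩ | ⟨a, b⟩
    · have : Quot.out s((u : ℕ), (v : ℕ)) = ((u : ℕ), (v : ℕ)) := Prod.ext a b
      simp [this]
    · have : Quot.out s((u : ℕ), (v : ℕ)) = ((v : ℕ), (u : ℕ)) := Prod.ext a b
      simp [this, add_comm]

theorem expect_oracle_degree (v : V) (f : ℕ → ℝ≥0∞) :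
    (G.oracle (.degree v)).expect f = f (G.deg v) := by
  classical
  rw [oracle]
  erw [PMF.expect_pure]
  simp [deg]

theorem expect_oracle_pair (u v : V) [Decidable (G.graph.Adj u v)] (f : Bool → ℝ≥0∞) :
    (G.oracle (.pair u v)).expect f = f (decide (G.graph.Adj u v)) := by
  classical
  rw [oracle]
  erw [PMF.expect_pure]
  simp

theorem expect_vertexDegree (f : ℕ → ℝ≥0∞) :
    (Prog.vertexDegree.eval G.oracle).expect f = (V.card : ℝ≥0∞)⁻¹ * ∑ v : V, f (G.deg v) := by
  simp only [Prog.vertexDegree, Prog.eval, PMF.expect_bind]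
  rw [show G.oracle .randVert = PMF.uniformOfFinset V G.nonempty from rfl]
  erw [PMF.expect_uniformOfFinset]
  congr 1
  refine (Finset.sum_coe_sort V _).symm.trans (Finset.sum_congr rfl fun v _ => ?_)
  erw [expect_oracle_degree, PMF.expect_pure]

theorem expect_dart (f : (ℕ × ℕ) × (ℕ × ℕ) → ℝ≥0∞) :
    (Prog.dart.eval G.oracle).expect f =
      (2 * G.numEdges : ℝ≥0∞)⁻¹ * G.dartSum fun u v => f ((u, v), (G.deg u, G.deg v)) := by
  classical
  set F : ℕ × ℕ → ℝ≥0∞ := fun a => (G.oracle (.degree a.1)).expect fun d₁ =>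
    (G.oracle (.degree a.2)).expect fun d₂ => f (a, (d₁, d₂)) with hF
  have hF' : ∀ u v : V, F (u, v) = f ((u, v), (G.deg u, G.deg v)) := by
    intro u v
    simp only [hF]
    erw [expect_oracle_degree, expect_oracle_degree]
  simp only [Prog.dart, Prog.eval, PMF.expect_bind, PMF.expect_pure, Prog.expect_fairCoin]
  rw [show G.oracle .randEdge = (PMF.uniformOfFinset G.graph.edgeFinset
    G.edgeFinset_nonempty).map (Sym2.map ((↑) : V → ℕ)) from rfl]
  erw [PMF.expect_map, PMF.expect_uniformOfFinset]
  rw [← Finset.mul_sum, ← mul_assoc, ← ENNReal.mul_inv (by simp) (by simp)]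
  rw [mul_comm (Finset.card _ : ℝ≥0∞)]
  congr 1
  · rw [← funext₂ hF', ← sum_edgeFinset_eq_dartSum]
    simp only [if_true, Bool.false_eq_true, if_false, hF]
    rfl

/-- A vertex is the origin of `deg` many darts, which gives the weights `deg u * deg v`. -/
theorem expect_dartPair (f : (ℕ × ℕ) × Bool → ℝ≥0∞) [DecidableRel G.graph.Adj] :
    (Prog.dartPair.eval G.oracle).expect f =
      ((2 * G.numEdges : ℝ≥0∞)⁻¹) ^ 2 *
        ∑ u, ∑ v, (G.deg u : ℝ≥0∞) * (G.deg v : ℝ≥0∞) *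
          f ((G.deg u, G.deg v), decide (G.graph.Adj u v)) := by
  simp only [Prog.dartPair, Prog.expect_eval_bind, expect_dart, Prog.eval, PMF.expect_bind,
    PMF.expect_pure]
  simp only [dartSum_fst, nsmul_eq_mul, Finset.mul_sum]
  refine Finset.sum_congr rfl fun u _ => Finset.sum_congr rfl fun v _ => ?_
  erw [expect_oracle_pair]
  ring

end InputGraph

/-! ### Accuracy of a trial. -/

namespace Prog

variable (O : (q : Query) → PMF q.Answer)

theorem expect_eval_map_sq_le {α : Type} (p : Prog α) {f : α → NNReal} (hf : ∀ a, f a ≤ 1) :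
    ((p.map f).eval O).expect (fun x => (x : ℝ≥0∞) ^ 2) ≤
      ((p.map f).eval O).expect (fun x => (x : ℝ≥0∞)) := by
  simp only [expect_eval_map]
  refine PMF.expect_mono _ fun a => ?_
  rw [sq]
  exact mul_le_of_le_one_left zero_le (by exact_mod_cast hf a)

open scoped Classical in
/-- A trial rarely returns an estimate outside `S` if accurate samples give an estimate in `S`, and
it rarely fails to return an estimate in `S` if moreover both means are large. -/
theorem expect_trial_of_accurate {α β : Type} {p : Prog α} {q : Prog β} {f : α → NNReal}
    {g : β → NNReal} (hf : ∀ a, f a ≤ 1) (hg : ∀ a, g a ≤ 1) {μ ν : NNReal}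
    (hμ : (p.eval O).expect (fun x => (f x : ℝ≥0∞)) = μ)
    (hν : (q.eval O).expect (fun x => (g x : ℝ≥0∞)) = ν)
    (N : ℕ) {η T : ℝ} (hη : 0 < η) (hη' : η ≤ 1 / 2) (hT : 0 < T) (out : ℝ → ℝ → ℝ) (S : Set ℝ)
    (hout : ∀ x y : ℝ, 0 < x → 0 < y → |x - N * μ| ≤ η * (N * μ) → |y - N * ν| ≤ η * (N * ν) →
      out x y ∈ S) :
    (((p.map f).trial (q.map g) N T out).eval O).expect
        (fun o => if ∃ r, r ∉ S ∧ o = some r then 1 else 0) ≤ ENNReal.ofReal (4 / (η ^ 2 * T)) ∧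
    (2 * T ≤ N * μ → 2 * T ≤ N * ν → (((p.map f).trial (q.map g) N T out).eval O).expect
        (fun o => if ¬ ∃ r ∈ S, o = some r then 1 else 0) ≤ ENNReal.ofReal (4 / (η ^ 2 * T))) := by
  have hμ' : ((p.map f).eval O).expect (fun x => (x : ℝ≥0∞)) = μ := by
    rw [expect_eval_map, hμ]
  have hν' : ((q.map g).eval O).expect (fun x => (x : ℝ≥0∞)) = ν := by
    rw [expect_eval_map, hν]
  have hout' : ∀ x y : NNReal, ¬ TestFails η T (N * μ) x → ¬ TestFails η T (N * ν) y →
      T ≤ x → T ≤ y → out x y ∈ S := by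
    intro x y hx hy hTx hTy
    simp only [TestFails, not_or, not_and, not_lt] at hx hy
    exact hout x y (by linarith) (by linarith) (hx.1 hTx) (hy.1 hTy)
  refine ⟨expect_trial_le O hμ' (hμ' ▸ expect_eval_map_sq_le O p hf) hν'
    (hν' ▸ expect_eval_map_sq_le O q hg) N hη hη' hT out _ ?_, fun h1 h2 => ?_⟩
  · rintro x y ⟨r, hr, h⟩
    by_contra hc
    push Not at hc
    split_ifs at h with hT'
    rw [Option.some.injEq] at h
    exact hr (h ▸ hout' x y hc.1 hc.2 hT'.1 hT'.2)
  · convert expect_trial_le O hμ' (hμ' ▸ expect_eval_map_sq_le O p hf) hν'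
      (hν' ▸ expect_eval_map_sq_le O q hg) N hη hη' hT out (fun o => ¬ ∃ r ∈ S, o = some r) ?_
    intro x y h
    by_contra hc
    push Not at hc
    have hx : T ≤ x := by
      have := hc.1
      simp only [TestFails, not_or, not_and, not_lt] at this
      exact this.2 h1
    have hy : T ≤ y := by
      have := hc.2
      simp only [TestFails, not_or, not_and, not_lt] at this
      exact this.2 h2
    refine h ⟨_, hout' x y hc.1 hc.2 hx hy, ?_⟩
    rw [if_pos ⟨hx, hy⟩]

end Prog

/-- A quotient of two accurate estimates is accurate. -/
theorem div_mem_Icc_of_accurate {ε N μ ν c x y : ℝ} (hε : 0 < ε) (hε1 : ε < 1) (hc : 0 ≤ c)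
    (hx : 0 < x) (hy : 0 < y) (hN : 0 ≤ N) (hμ : 0 ≤ μ) (hν : 0 ≤ ν)
    (h1 : |x - N * μ| ≤ ε / 4 * (N * μ)) (h2 : |y - N * ν| ≤ ε / 4 * (N * ν)) :
    0 < μ ∧ 0 < ν ∧ c * (x / y) ∈ Set.Icc (c * (μ / ν) / (1 + ε)) ((1 + ε) * (c * (μ / ν))) := by
  rw [abs_le] at h1 h2
  have hμ0 : 0 < N * μ := by
    rcases (mul_nonneg hN hμ).lt_or_eq with h | h
    · exact h
    · rw [← h] at h1; linarith [h1.2]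
  have hν0 : 0 < N * ν := by
    rcases (mul_nonneg hN hν).lt_or_eq with h | h
    · exact h
    · rw [← h] at h2; linarith [h2.2]
  -- A positive sum cannot be accurate for a zero mean, so both means are positive. Callers need
  -- this to cancel a common factor from the quotient of the means.
  have hN0 : 0 < N := hN.lt_of_ne (by rintro rfl; simp at hμ0)
  have hμp : 0 < μ := by
    by_contra h
    nlinarith
  have hνp : 0 < ν := by
    by_contra h
    nlinarith
  refine ⟨hμp, hνp, ?_, ?_⟩
  · have key : μ / ν / (1 + ε) ≤ x / y := by
      rw [div_div, div_le_div_iff₀ (by positivity) hy]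
      have a1 : μ * y ≤ μ * ((1 + ε / 4) * (N * ν)) := by
        apply mul_le_mul_of_nonneg_left _ hμ; linarith
      have a2 : (1 - ε / 4) * (N * μ) * (ν * (1 + ε)) ≤ x * (ν * (1 + ε)) := by
        apply mul_le_mul_of_nonneg_right _ (by positivity); linarith
      -- The bracket equals `ε / 2 - ε² / 4`: two relative errors `ε / 4` combine to a factor of at
      -- most `1 + ε`.
      have a3 : 0 ≤ (N * μ * ν) * ((1 - ε / 4) * (1 + ε) - (1 + ε / 4)) := by
        apply mul_nonneg (by positivity); nlinarith
      nlinarith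
    calc c * (μ / ν) / (1 + ε) = c * (μ / ν / (1 + ε)) := by ring
      _ ≤ _ := mul_le_mul_of_nonneg_left key hc
  · have key : x / y ≤ (1 + ε) * (μ / ν) := by
      rw [← mul_div_assoc, div_le_div_iff₀ hy hνp]
      have a1 : x * ν ≤ (1 + ε / 4) * (N * μ) * ν := by
        apply mul_le_mul_of_nonneg_right _ hν; linarith
      have a2 : (1 + ε) * μ * ((1 - ε / 4) * (N * ν)) ≤ (1 + ε) * μ * y := by
        apply mul_le_mul_of_nonneg_left _ (by positivity); linarith
      have a3 : 0 ≤ (N * μ * ν) * ((1 - ε / 4) * (1 + ε) - (1 + ε / 4)) := by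
        apply mul_nonneg (by positivity); nlinarith
      nlinarith
    calc c * (x / y) ≤ c * ((1 + ε) * (μ / ν)) := mul_le_mul_of_nonneg_left key hc
      _ = _ := by ring

/-! ### Low and high degrees, and the means of the sampled statistics. -/

namespace InputGraph

variable {V : Finset ℕ} (G : InputGraph V)

theorem card_pos (G : InputGraph V) : 0 < V.card := G.nonempty.card_pos

theorem numEdges_pos : 0 < G.numEdges := G.edgeFinset_nonempty.card_pos

theorem coe_dartSum (f : V → V → NNReal) :
    ((G.dartSum f : NNReal) : ℝ≥0∞) = G.dartSum fun u v => (f u v : ℝ≥0∞) := by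
  simp only [dartSum, ENNReal.ofNNReal_finsetSum, apply_ite ((↑) : NNReal → ℝ≥0∞), ENNReal.coe_zero]

theorem expect_dart_coe (f : (ℕ × ℕ) × (ℕ × ℕ) → NNReal) :
    (Prog.dart.eval G.oracle).expect (fun x => (f x : ℝ≥0∞)) =
      (((2 * G.numEdges : NNReal)⁻¹ * G.dartSum fun u v => f ((u, v), (G.deg u, G.deg v)) :
        NNReal) : ℝ≥0∞) := by
  have h : (2 * G.numEdges : NNReal) ≠ 0 := by simp [G.numEdges_pos.ne']
  rw [expect_dart, ENNReal.coe_mul, ENNReal.coe_inv h, coe_dartSum]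
  push_cast
  rfl

theorem expect_vertexDegree_coe (f : ℕ → NNReal) :
    (Prog.vertexDegree.eval G.oracle).expect (fun x => (f x : ℝ≥0∞)) =
      (((V.card : NNReal)⁻¹ * ∑ v : V, f (G.deg v) : NNReal) : ℝ≥0∞) := by
  have h : (V.card : NNReal) ≠ 0 := by simp [G.card_pos.ne']
  rw [expect_vertexDegree, ENNReal.coe_mul, ENNReal.coe_inv h]
  push_cast
  rfl

open scoped Classical in
theorem expect_dartPair_coe (f : (ℕ × ℕ) × Bool → NNReal) :
    (Prog.dartPair.eval G.oracle).expect (fun x => (f x : ℝ≥0∞)) =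
      ((((2 * G.numEdges : NNReal)⁻¹) ^ 2 * ∑ u, ∑ v, (G.deg u : NNReal) * (G.deg v : NNReal) *
          f ((G.deg u, G.deg v), decide (G.graph.Adj u v)) : NNReal) : ℝ≥0∞) := by
  have h : (2 * G.numEdges : NNReal) ≠ 0 := by simp [G.numEdges_pos.ne']
  rw [expect_dartPair, ENNReal.coe_mul, ENNReal.coe_pow, ENNReal.coe_inv h]
  push_cast
  rfl

/-- The sum of the degrees of the vertices of degree at most `τ`. -/
def lowSum (τ : ℕ) : ℕ := ∑ v, if G.deg v ≤ τ then G.deg v else 0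

/-- The number of ordered pairs of adjacent vertices of degree more than `τ`. -/
def highSum (τ : ℕ) : ℕ := G.dartSum fun u v => if τ < G.deg u ∧ τ < G.deg v then 1 else 0

/-- Every dart has a low origin, a low end, or two high endpoints; reversing darts shows that the
first two kinds are equally numerous. -/
theorem two_mul_numEdges_le (τ : ℕ) : 2 * G.numEdges ≤ 2 * G.lowSum τ + G.highSum τ := by
  classical
  have hlow : G.lowSum τ = G.dartSum fun u _ => if G.deg u ≤ τ then 1 else 0 := by
    rw [dartSum_fst, lowSum]
    refine Finset.sum_congr rfl fun v _ => ?_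
    split_ifs <;> simp
  have hlow' : G.lowSum τ = G.dartSum fun _ v => if G.deg v ≤ τ then 1 else 0 := by
    rw [hlow, dartSum, dartSum, Finset.sum_comm]
    simp only [G.graph.adj_comm]
  have hall : 2 * G.numEdges = G.dartSum fun _ _ => 1 := by
    rw [← sum_deg, dartSum_fst]; simp
  rw [two_mul (G.lowSum τ)]
  nth_rewrite 1 [hlow]
  rw [hlow', hall, highSum]
  simp only [dartSum, ← Finset.sum_add_distrib]
  refine Finset.sum_le_sum fun u _ => Finset.sum_le_sum fun v _ => ?_
  by_cases h1 : G.deg u ≤ τ <;> by_cases h2 : G.deg v ≤ τ <;>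
    split_ifs <;> omega

end InputGraph

namespace Prog

/-- The reciprocal of the degree of the origin of a dart. -/
def invDegree (x : (ℕ × ℕ) × (ℕ × ℕ)) : NNReal := (x.2.1 : NNReal)⁻¹

/-- The normalized degree of a vertex, if it is low. -/
def lowDegree (τ : ℕ) (d : ℕ) : NNReal := if d ≤ τ then d / τ else 0

/-- The indicator of darts with low origin. -/
def lowOrigin (τ : ℕ) (x : (ℕ × ℕ) × (ℕ × ℕ)) : NNReal := if x.2.1 ≤ τ then 1 else 0

/-- The indicator of adjacent pairs of high vertices, weighted by the reciprocals of their
degrees. -/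
def highPair (τ : ℕ) (x : (ℕ × ℕ) × Bool) : NNReal :=
  if τ < x.1.1 ∧ τ < x.1.2 ∧ x.2 = true then τ ^ 2 / (x.1.1 * x.1.2) else 0

/-- The indicator of darts with two high endpoints. -/
def highEnds (τ : ℕ) (x : (ℕ × ℕ) × (ℕ × ℕ)) : NNReal :=
  if τ < x.2.1 ∧ τ < x.2.2 then 1 else 0

theorem invDegree_le_one (x) : invDegree x ≤ 1 := by
  unfold invDegree
  rcases Nat.eq_zero_or_pos x.2.1 with h | h
  · simp [h]
  · exact inv_le_one_of_one_le₀ (by exact_mod_cast h)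

theorem lowDegree_le_one (τ d : ℕ) : lowDegree τ d ≤ 1 := by
  unfold lowDegree
  split_ifs with h
  · exact div_le_one_of_le₀ (by exact_mod_cast h) zero_le
  · exact zero_le

theorem lowOrigin_le_one (τ : ℕ) (x) : lowOrigin τ x ≤ 1 := by
  unfold lowOrigin
  split_ifs <;> simp

theorem highEnds_le_one (τ : ℕ) (x) : highEnds τ x ≤ 1 := by
  unfold highEnds
  split_ifs <;> simp

theorem highPair_le_one (τ : ℕ) (x) : highPair τ x ≤ 1 := by
  unfold highPair
  split_ifs with h
  · refine div_le_one_of_le₀ ?_ zero_le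
    rw [sq]
    exact mul_le_mul' (by exact_mod_cast h.1.le) (by exact_mod_cast h.2.1.le)
  · exact zero_le

end Prog

namespace InputGraph

open Prog

variable {V : Finset ℕ} (G : InputGraph V)

/-- Summing `1 / deg u` over the darts out of `u` gives 1, so the mean is `n / (2m) = 1 / d`. -/
theorem expect_invDegree :
    (Prog.dart.eval G.oracle).expect (fun x => (invDegree x : ℝ≥0∞)) =
      (((2 * G.numEdges : NNReal)⁻¹ * V.card : NNReal) : ℝ≥0∞) := by
  rw [expect_dart_coe]
  congr 2
  simp only [invDegree, dartSum_fst, nsmul_eq_mul]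
  rw [Finset.sum_congr rfl fun u _ => mul_inv_cancel₀ (by simp [(G.deg_pos u).ne'])]
  simp

theorem expect_lowDegree (τ : ℕ) :
    (Prog.vertexDegree.eval G.oracle).expect (fun x => (lowDegree τ x : ℝ≥0∞)) =
      (((V.card : NNReal)⁻¹ * (G.lowSum τ / τ) : NNReal) : ℝ≥0∞) := by
  rw [expect_vertexDegree_coe]
  congr 2
  rw [lowSum]
  push_cast
  rw [Finset.sum_div]
  refine Finset.sum_congr rfl fun v _ => ?_
  unfold lowDegree
  split_ifs <;> simp

/-- The unknown `lowSum` cancels against `expect_lowDegree`: if it is nonzero, `τ` times the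
quotient of the two means is `2m / n = d`. -/
theorem expect_lowOrigin (τ : ℕ) :
    (Prog.dart.eval G.oracle).expect (fun x => (lowOrigin τ x : ℝ≥0∞)) =
      (((2 * G.numEdges : NNReal)⁻¹ * G.lowSum τ : NNReal) : ℝ≥0∞) := by
  rw [expect_dart_coe]
  congr 2
  refine (G.dartSum_fst fun u => if G.deg u ≤ τ then (1 : NNReal) else 0).trans ?_
  rw [lowSum]
  push_cast
  refine Finset.sum_congr rfl fun v _ => ?_
  split_ifs <;> simp

theorem expect_highEnds (τ : ℕ) :
    (Prog.dart.eval G.oracle).expect (fun x => (highEnds τ x : ℝ≥0∞)) =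
      (((2 * G.numEdges : NNReal)⁻¹ * G.highSum τ : NNReal) : ℝ≥0∞) := by
  rw [expect_dart_coe]
  congr 2
  simp only [highEnds, dartSum, highSum]
  push_cast
  rfl

/-- The weights `1 / (deg u * deg v)` undo the degree bias of the two origins. If `highSum` is
nonzero it cancels against `expect_highEnds`, leaving `2m / τ²`. -/
theorem expect_highPair (τ : ℕ) :
    (Prog.dartPair.eval G.oracle).expect (fun x => (highPair τ x : ℝ≥0∞)) =
      ((((2 * G.numEdges : NNReal)⁻¹) ^ 2 * (τ ^ 2 * G.highSum τ) : NNReal) : ℝ≥0∞) := by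
  classical
  rw [expect_dartPair_coe]
  congr 2
  simp only [highPair, dartSum, highSum]
  push_cast
  simp only [Finset.mul_sum]
  refine Finset.sum_congr rfl fun u _ => Finset.sum_congr rfl fun v _ => ?_
  have hu : (G.deg u : NNReal) ≠ 0 := by simp [(G.deg_pos u).ne']
  have hv : (G.deg v : NNReal) ≠ 0 := by simp [(G.deg_pos v).ne']
  by_cases h1 : G.graph.Adj u v <;> by_cases h2 : τ < G.deg u <;> by_cases h3 : τ < G.deg v <;>
    simp [h1, h2, h3]
  field_simp

end InputGraph

/-! ### The schedule of trials and its cost. -/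

/-- The trials of the algorithm: `j` is the logarithm of the budget and `i` the logarithm of the
degree threshold. -/
inductive TrialKind where
  | edge (j : ℕ)
  | low (j i : ℕ)
  | high (j i : ℕ)

namespace TrialKind

open Prog

/-- The trial with budget exponent `j` works with `sampleSize T j` samples. -/
def sampleSize (T : ℝ) (j : ℕ) : ℕ := ⌈16 * T * 2 ^ j⌉₊

/-- The program of a trial. -/
def prog (n : ℕ) (T : ℝ) : TrialKind → Prog (Option ℝ)
  | edge j => (dart.map invDegree).trial ((ret ()).map fun _ => 1) (sampleSize T j) T
      fun x y => 1 * (y / x)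
  | low j i => (vertexDegree.map (lowDegree (2 ^ i))).trial (dart.map (lowOrigin (2 ^ i)))
      (sampleSize T j) T fun x y => 2 ^ i * (x / y)
  | high j i => (dartPair.map (highPair (2 ^ i))).trial (dart.map (highEnds (2 ^ i)))
      (sampleSize T j) T fun x y => (2 ^ i) ^ 2 / n * (y / x)

/-- An upper bound on the number of queries of a trial. -/
def cost (T : ℝ) : TrialKind → ℕ
  | edge j => sampleSize T j * 10
  | low j _ => sampleSize T j * 10
  | high j _ => sampleSize T j * 10

theorem costLE_prog (n : ℕ) (T : ℝ) (t : TrialKind) : (t.prog n T).CostLE (t.cost T) := by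
  cases t with
  | edge j =>
    rw [prog, cost]
    exact (CostLE.trial (costLE_dart.map _)
      (c' := 0) (CostLE.map (show (ret ()).CostLE 0 from trivial) _) _ _ _).mono
      (Nat.mul_le_mul_left _ (show 3 + 0 ≤ 10 by norm_num))
  | low j i =>
    rw [prog, cost]
    exact (CostLE.trial (costLE_vertexDegree.map _) (costLE_dart.map _) _ _ _).mono
      (Nat.mul_le_mul_left _ (show 2 + 3 ≤ 10 by norm_num))
  | high j i =>
    rw [prog, cost]
    exact (CostLE.trial (costLE_dartPair.map _) (costLE_dart.map _) _ _ _).mono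
      (Nat.mul_le_mul_left _ (show 7 + 3 ≤ 10 by norm_num))

/-- The trials with budget exponent `j`. -/
def level (l j : ℕ) : List TrialKind :=
  edge j :: (List.range (l + 1)).flatMap fun i => [low j i, high j i]

theorem length_level (l j : ℕ) : (level l j).length = 2 * l + 3 := by
  simp [level, List.length_flatMap]
  ring

theorem sum_cost_level (T : ℝ) (l j : ℕ) :
    ((level l j).map (cost T)).sum = (2 * l + 3) * (sampleSize T j * 10) := by
  rw [← length_level l j, ← smul_eq_mul, ← List.length_map (cost T)]
  refine List.sum_eq_card_nsmul _ _ fun x hx => ?_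
  obtain ⟨t, ht, rfl⟩ := List.mem_map.1 hx
  simp only [level, List.mem_cons, List.mem_flatMap, List.mem_range, List.not_mem_nil,
    or_false] at ht
  rcases ht with rfl | ⟨i, -, rfl | rfl⟩ <;> rfl

theorem length_flatMap_level (l j : ℕ) :
    ((List.range j).flatMap (level l)).length = j * (2 * l + 3) := by
  simp [List.length_flatMap, length_level]

/-- The costs grow geometrically, so all levels below `j` cost at most as much as the bound for one
level `j`. The constant is `17 * 10`: rounding turns 16 into 17, and a sample costs at most 10
queries. -/
theorem sum_cost_flatMap_level {T : ℝ} (hT : 1 ≤ T) (l j : ℕ) :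
    ((((List.range j).flatMap (level l)).map (cost T)).sum : ℝ) ≤
      (2 * l + 3) * (170 * T * 2 ^ j) := by
  induction j with
  | zero => simp; positivity
  | succ j ih =>
    rw [List.range_succ, List.flatMap_append, List.map_append, List.sum_append, List.flatMap_singleton,
      sum_cost_level]
    simp only [Nat.cast_add, Nat.cast_mul, Nat.cast_ofNat]
    have hN : (sampleSize T j : ℝ) ≤ 17 * T * 2 ^ j := by
      have h1 : (1 : ℝ) ≤ T * 2 ^ j := by
        nlinarith [one_le_pow₀ (n := j) (one_le_two (α := ℝ))]
      have := Nat.ceil_lt_add_one (a := 16 * T * 2 ^ j) (by positivity)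
      rw [sampleSize]
      linarith
    have h2 : (2 * (l : ℝ) + 3) * (sampleSize T j * 10) ≤
        (2 * (l : ℝ) + 3) * (17 * T * 2 ^ j * 10) := by gcongr
    rw [pow_succ]
    linarith

end TrialKind

/-! ### Soundness of all trials and success of one of them. -/

namespace InputGraph

open Prog TrialKind

variable {V : Finset ℕ} (G : InputGraph V)

/-- The set of `(1 + ε)`-approximations to the average degree. -/
def approxSet (ε : ℝ) : Set ℝ := Set.Icc (G.avgDegree / (1 + ε)) ((1 + ε) * G.avgDegree)

open scoped Classical in
/-- No trial is likely to return a bad estimate. -/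
theorem expect_prog_bad_le {ε T : ℝ} (hε : 0 < ε) (hε1 : ε < 1) (hT : 0 < T) (t : TrialKind) :
    ((t.prog V.card T).eval G.oracle).expect
      (fun o => if ∃ r, r ∉ G.approxSet ε ∧ o = some r then 1 else 0) ≤
        ENNReal.ofReal (4 / ((ε / 4) ^ 2 * T)) ∧
    (∀ j, t = edge j →
      2 * T ≤ sampleSize T j * ((2 * (G.numEdges : ℝ))⁻¹ * V.card) →
      2 * T ≤ sampleSize T j →
      ((t.prog V.card T).eval G.oracle).expect
        (fun o => if ¬ ∃ r ∈ G.approxSet ε, o = some r then 1 else 0) ≤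
        ENNReal.ofReal (4 / ((ε / 4) ^ 2 * T))) ∧
    (∀ j i, t = low j i →
      2 * T ≤ sampleSize T j * ((V.card : ℝ)⁻¹ * (G.lowSum (2 ^ i) / 2 ^ i)) →
      2 * T ≤ sampleSize T j * ((2 * (G.numEdges : ℝ))⁻¹ * G.lowSum (2 ^ i)) →
      ((t.prog V.card T).eval G.oracle).expect
        (fun o => if ¬ ∃ r ∈ G.approxSet ε, o = some r then 1 else 0) ≤
        ENNReal.ofReal (4 / ((ε / 4) ^ 2 * T))) ∧
    (∀ j i, t = high j i →
      2 * T ≤ sampleSize T j * ((2 * (G.numEdges : ℝ))⁻¹ ^ 2 * ((2 ^ i) ^ 2 * G.highSum (2 ^ i))) →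
      2 * T ≤ sampleSize T j * ((2 * (G.numEdges : ℝ))⁻¹ * G.highSum (2 ^ i)) →
      ((t.prog V.card T).eval G.oracle).expect
        (fun o => if ¬ ∃ r ∈ G.approxSet ε, o = some r then 1 else 0) ≤
        ENNReal.ofReal (4 / ((ε / 4) ^ 2 * T))) := by
  have hn : (0 : ℝ) < V.card := by exact_mod_cast G.card_pos
  have hm : (0 : ℝ) < G.numEdges := by exact_mod_cast G.numEdges_pos
  cases t with
  | edge j =>
    -- The second sample is the constant 1, so that the same quotient analysis covers the inverse of
    -- a single mean.
    have h1 : (((ret ()).eval G.oracle).expect fun _ => ((1 : NNReal) : ℝ≥0∞)) =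
      ((1 : NNReal) : ℝ≥0∞) := PMF.expect_const _ _
    have h := expect_trial_of_accurate G.oracle invDegree_le_one (fun _ => le_rfl)
      G.expect_invDegree h1 (sampleSize T j)
      (η := ε / 4) (by positivity) (by linarith) hT (fun x y => 1 * (y / x)) (G.approxSet ε) ?_
    · refine ⟨h.1, ?_, by simp, by simp⟩
      rintro j' ⟨⟩ h1 h2
      refine h.2 ?_ ?_
      · simpa using h1
      · simpa using h2
    · intro x y hx hy h1 h2
      have := (div_mem_Icc_of_accurate hε hε1 zero_le_one hy hx (by positivity) (by positivity)
        (by positivity) h2 h1).2.2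
      convert this using 1
      rw [approxSet, avgDegree]
      push_cast
      congr 2 <;> field_simp
  | low j i =>
    have h := expect_trial_of_accurate G.oracle (lowDegree_le_one (2 ^ i)) (lowOrigin_le_one (2 ^ i))
      (G.expect_lowDegree (2 ^ i)) (G.expect_lowOrigin (2 ^ i)) (sampleSize T j)
      (η := ε / 4) (by positivity) (by linarith) hT (fun x y => 2 ^ i * (x / y)) (G.approxSet ε) ?_
    · refine ⟨h.1, by simp, ?_, by simp⟩
      rintro j' i' ⟨⟩ h1 h2
      refine h.2 ?_ ?_
      · simpa using h1
      · simpa using h2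
    · intro x y hx hy h1 h2
      obtain ⟨-, hpos, this⟩ := div_mem_Icc_of_accurate (c := 2 ^ i) hε hε1 (by positivity) hx hy
        (by positivity) (by positivity) (by positivity) h1 h2
      convert this using 1
      have hs : (G.lowSum (2 ^ i) : ℝ) ≠ 0 := by
        intro h0
        simp at hpos h0
        simp [h0] at hpos
      rw [approxSet, avgDegree]
      push_cast
      congr 2 <;> field_simp
  | high j i =>
    have h := expect_trial_of_accurate G.oracle (highPair_le_one (2 ^ i)) (highEnds_le_one (2 ^ i))
      (G.expect_highPair (2 ^ i)) (G.expect_highEnds (2 ^ i)) (sampleSize T j)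
      (η := ε / 4) (by positivity) (by linarith) hT (fun x y => (2 ^ i) ^ 2 / V.card * (y / x))
      (G.approxSet ε) ?_
    · refine ⟨h.1, by simp, by simp, ?_⟩
      rintro j' i' ⟨⟩ h1 h2
      refine h.2 ?_ ?_
      · simpa using h1
      · simpa using h2
    · intro x y hx hy h1 h2
      obtain ⟨hpos, -, this⟩ := div_mem_Icc_of_accurate (c := (2 ^ i) ^ 2 / V.card) hε hε1
        (by positivity) hy hx (by positivity) (by positivity) (by positivity) h2 h1
      convert this using 1
      have hs : (G.highSum (2 ^ i) : ℝ) ≠ 0 := by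
        intro h0
        simp at hpos h0
        simp [h0] at hpos
      rw [approxSet, avgDegree]
      push_cast
      congr 2 <;> field_simp

theorem one_le_avgDegree : 1 ≤ G.avgDegree := by
  have hn : (0 : ℝ) < V.card := by exact_mod_cast G.card_pos
  rw [avgDegree, le_div_iff₀ hn, one_mul]
  have h : V.card ≤ 2 * G.numEdges := by
    rw [← sum_deg]
    calc V.card = ∑ _v : V, 1 := by simp
      _ ≤ _ := Finset.sum_le_sum fun v _ => G.deg_pos v
  exact_mod_cast h

theorem avgDegree_lt_card : G.avgDegree < V.card := by
  classical
  have hn : (0 : ℝ) < V.card := by exact_mod_cast G.card_pos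
  rw [avgDegree, div_lt_iff₀ hn]
  have h : 2 * G.numEdges < V.card * V.card := by
    rw [← sum_deg]
    calc _ < ∑ _v : V, V.card := by
          refine Finset.sum_lt_sum_of_nonempty ?_ fun v _ => ?_
          · obtain ⟨v, hv⟩ := G.nonempty
            exact ⟨⟨v, hv⟩, Finset.mem_univ _⟩
          · have := G.graph.degree_lt_card_verts v
            rwa [Fintype.card_coe] at this
      _ = _ := by simp
  exact_mod_cast h

theorem two_mul_numEdges : 2 * (G.numEdges : ℝ) = V.card * G.avgDegree := by
  have hn : (0 : ℝ) < V.card := by exact_mod_cast G.card_pos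
  rw [avgDegree]
  field_simp

open scoped Classical in
/-- With a sufficient budget, one of the trials is likely to return a good estimate. -/
theorem exists_trial {ε T : ℝ} (hε : 0 < ε) (hε1 : ε < 1) (hT : 0 < T) {l j : ℕ}
    (hl : V.card < 2 ^ l) (h2 : 2 ≤ V.card)
    (hj : G.avgDegree ≤ 2 ^ j ∨ V.card ≤ (2 ^ j) ^ 3 * G.avgDegree)
    (hj' : (2 : ℝ) ^ j ≤ 2 * G.avgDegree) :
    ∃ t ∈ level l j, ((t.prog V.card T).eval G.oracle).expect
        (fun o => if ¬ ∃ r ∈ G.approxSet ε, o = some r then 1 else 0) ≤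
        ENNReal.ofReal (4 / ((ε / 4) ^ 2 * T)) := by
  have hm : (0 : ℝ) < G.numEdges := by exact_mod_cast G.numEdges_pos
  have h2' : (2 : ℝ) ≤ V.card := by exact_mod_cast h2
  have h3 : (V.card : ℝ) < 2 ^ l := by exact_mod_cast hl
  have hd1 := G.one_le_avgDegree
  have hdn := G.avgDegree_lt_card
  have hnd := G.two_mul_numEdges
  have hN : 16 * T * 2 ^ j ≤ sampleSize T j := Nat.le_ceil _
  set N : ℝ := (sampleSize T j : ℝ) with hNdef
  set d := G.avgDegree
  set n : ℝ := (V.card : ℝ)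
  set B : ℝ := 2 ^ j with hB
  have hB1 : 1 ≤ B := one_le_pow₀ one_le_two
  have hN1 : 16 * T ≤ N := by nlinarith
  have hN0 : 0 < N := by linarith
  rcases hj with hj | hj
  · refine ⟨edge j, by simp [level], (G.expect_prog_bad_le hε hε1 hT _).2.1 j rfl ?_ ?_⟩
    · rw [hnd]
      have h1 : (n * d)⁻¹ * n = 1 / d := by field_simp
      rw [h1, mul_one_div, le_div_iff₀ (by linarith)]
      nlinarith
    · linarith
  -- Here `B ≤ 2 d ≤ n d` enters: the budget must not exceed `n d` for a threshold to exist.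
  · have hx1 : 1 ≤ n * d / B := by
      rw [le_div_iff₀ (by linarith)]
      nlinarith
    -- Rounds `n d / B` up to a power of 4, so that `τ = 2 ^ i` satisfies `n d / B ≤ τ² ≤ 4 n d /
    -- B`. The lower bound serves the high trial. The upper one gives `τ ≤ 2 B d` through `n ≤ B³ d`
    -- and serves the low trial.
    obtain ⟨a, ha1, ha2⟩ := exists_nat_pow_near hx1 (show (1 : ℝ) < 4 by norm_num)
    set i := a + 1
    have hal : a < l := by
      have h4 : (4 : ℝ) ^ a < 4 ^ l := by
        refine ha1.trans_lt ?_
        rw [div_lt_iff₀ (by linarith), show (4 : ℝ) = 2 * 2 by norm_num, mul_pow]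
        have : (0 : ℝ) < 2 ^ l := by positivity
        nlinarith [mul_pos this this]
      exact (pow_lt_pow_iff_right₀ (by norm_num)).1 h4
    have hil : i < l + 1 := by omega
    have hτ1 : n * d / B ≤ ((2 : ℝ) ^ i) ^ 2 := by
      rw [← pow_mul, mul_comm i 2, pow_mul]
      norm_num
      exact ha2.le
    have hτ2 : (2 : ℝ) ^ i ≤ 2 * B * d := by
      have h5 : ((2 : ℝ) ^ i) ^ 2 ≤ (2 * B * d) ^ 2 := by
        calc ((2 : ℝ) ^ i) ^ 2 = 4 * 4 ^ a := by
              rw [← pow_mul, mul_comm i 2, pow_mul, ← pow_succ']; norm_num [i]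
          _ ≤ 4 * (n * d / B) := by linarith
          _ ≤ 4 * (B ^ 3 * d * d / B) := by gcongr
          _ = (2 * B * d) ^ 2 := by field_simp; ring
      exact le_of_sq_le_sq h5 (by positivity) 
    have hτ0 : (0 : ℝ) < 2 ^ i := by positivity
    set τ : ℝ := 2 ^ i with hτ
    have hsum : 2 * (G.numEdges : ℝ) ≤ 2 * G.lowSum (2 ^ i) + G.highSum (2 ^ i) := by
      exact_mod_cast G.two_mul_numEdges_le (2 ^ i)
    -- Either `highSum ≥ m`, or `lowSum ≥ m / 2`.
    rcases le_or_gt (G.numEdges : ℝ) (G.highSum (2 ^ i)) with hh | hh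
    · refine ⟨high j i, ?_, (G.expect_prog_bad_le hε hε1 hT _).2.2.2 j i rfl ?_ ?_⟩
      · simp only [level, List.mem_cons, List.mem_flatMap, List.mem_range]
        exact Or.inr ⟨i, hil, by simp⟩
      · have hh' : 2 * (G.numEdges : ℝ) / 2 ≤ (G.highSum (2 ^ i) : ℝ) := by linarith
        rw [hnd] at hh' ⊢
        have h6 : 1 / (2 * B) ≤ (n * d)⁻¹ ^ 2 * (τ ^ 2 * (G.highSum (2 ^ i) : ℝ)) := by
          calc 1 / (2 * B) = (n * d)⁻¹ ^ 2 * (n * d / B * (n * d / 2)) := by field_simp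
            _ ≤ _ := by gcongr
        calc 2 * T ≤ 16 * T * B * (1 / (2 * B)) := by field_simp; linarith
          _ ≤ _ := by gcongr
      · have h6 : (1 : ℝ) / 2 ≤ (2 * (G.numEdges : ℝ))⁻¹ * G.highSum (2 ^ i) := by
          rw [inv_mul_eq_div, le_div_iff₀ (by positivity)]
          linarith
        nlinarith
    · have hlow : (G.numEdges : ℝ) / 2 ≤ G.lowSum (2 ^ i) := by linarith
      refine ⟨low j i, ?_, (G.expect_prog_bad_le hε hε1 hT _).2.2.1 j i rfl ?_ ?_⟩
      · simp only [level, List.mem_cons, List.mem_flatMap, List.mem_range]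
        exact Or.inr ⟨i, hil, by simp⟩
      · have hlow' : 2 * (G.numEdges : ℝ) / 4 ≤ (G.lowSum (2 ^ i) : ℝ) := by linarith
        rw [hnd] at hlow'
        have h6 : 1 / (8 * B) ≤ n⁻¹ * ((G.lowSum (2 ^ i) : ℝ) / τ) := by
          calc 1 / (8 * B) = n⁻¹ * ((n * d / 4) / (2 * B * d)) := by field_simp; norm_num
            _ ≤ _ := by gcongr
        -- The smallest of the means to be reached is `1 / (8 B)`, which dictates the factor 16 in
        -- `sampleSize`.
        calc 2 * T ≤ 16 * T * B * (1 / (8 * B)) := by field_simp; linarith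
          _ ≤ _ := by gcongr
      · have h6 : (1 : ℝ) / 4 ≤ (2 * (G.numEdges : ℝ))⁻¹ * G.lowSum (2 ^ i) := by
          rw [inv_mul_eq_div, le_div_iff₀ (by positivity)]
          linarith
        nlinarith

end InputGraph


/-! ### The estimator and its query bound. -/

open TrialKind

/-- The logarithmic number of budgets and of thresholds. -/
def numLevels (n : ℕ) : ℕ := Nat.log 2 n + 1

/-- The threshold of the tests. -/
def testThreshold (n : ℕ) (ε : ℝ) : ℝ :=
  6401 * ((numLevels n + 1) * (2 * numLevels n + 3)) / ε ^ 2

/-- The estimator of the average degree. -/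
def avgDegreeProg (n : ℕ) (ε : ℝ) : Prog ℝ :=
  Prog.firstSome (prog n (testThreshold n ε))
    ((List.range (numLevels n + 1)).flatMap (level (numLevels n)))

theorem numLevels_le {n : ℕ} (hn : 2 ≤ n) : (numLevels n : ℝ) ≤ 3 * Real.log n := by
  have h2 : (0.6931471803 : ℝ) < Real.log 2 := Real.log_two_gt_d9
  have h1 : ((2 ^ Nat.log 2 n : ℕ) : ℝ) ≤ n := by exact_mod_cast Nat.pow_log_le_self 2 (by omega)
  have h3 := Real.log_le_log (by positivity) h1
  rw [Nat.cast_pow, Real.log_pow, Nat.cast_ofNat] at h3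
  have h4 : Real.log 2 ≤ Real.log n := Real.log_le_log (by norm_num) (by exact_mod_cast hn)
  rw [numLevels]
  push_cast
  have h5 : (0 : ℝ) ≤ Nat.log 2 n := by positivity
  nlinarith

theorem le_cube_of_rpow_third_le {x y : ℝ} (hx : 0 ≤ x) (h : x ^ (1 / 3 : ℝ) ≤ y) :
    x ≤ y ^ 3 :=
  calc x = (x ^ (1 / 3 : ℝ)) ^ 3 := by
        rw [← Real.rpow_natCast, ← Real.rpow_mul hx]; norm_num
    _ ≤ _ := by gcongr

/-- One term increases with `d`, the other decreases, and they cross at `d = n^(1/4)`. -/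
theorem min_le_rpow_quarter {d n : ℝ} (hd : 1 ≤ d) (hn : 1 ≤ n) :
    min d ((n / d) ^ (1 / 3 : ℝ)) ≤ n ^ (1 / 4 : ℝ) := by
  rcases le_or_gt d (n ^ (1 / 4 : ℝ)) with h | h
  · exact (min_le_left _ _).trans h
  · refine (min_le_right _ _).trans ?_
    have hn0 : 0 < n := by linarith
    have h1 : n / d ≤ n ^ (3 / 4 : ℝ) := by
      rw [div_le_iff₀ (by linarith)]
      calc n = n ^ (3 / 4 : ℝ) * n ^ (1 / 4 : ℝ) := by
            rw [← Real.rpow_add hn0]; norm_num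
        _ ≤ _ := by gcongr
    calc (n / d) ^ (1 / 3 : ℝ) ≤ (n ^ (3 / 4 : ℝ)) ^ (1 / 3 : ℝ) := by
          apply Real.rpow_le_rpow (by positivity) h1 (by norm_num)
      _ = _ := by rw [← Real.rpow_mul hn0.le]; norm_num

namespace InputGraph

variable {V : Finset ℕ} (G : InputGraph V)

theorem two_le_card (G : InputGraph V) : 2 ≤ V.card := by
  have h1 := G.one_le_avgDegree.trans_lt G.avgDegree_lt_card
  have : 1 < V.card := by exact_mod_cast h1
  omega

open scoped Classical in
theorem approxProb_eq_expect (A : QueryAlgorithm) (b : ℕ) (ε : ℝ) :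
    A.approxProb G b (1 + ε) = (A.run G.oracle b A.init).expect
      fun o => if ∃ r ∈ G.approxSet ε, o = some r then 1 else 0 := by
  rw [QueryAlgorithm.approxProb, PMF.toOuterMeasure_eq_expect]
  congr 1
  funext o
  congr 1
  simp only [Set.mem_ofPred_eq, approxSet, Set.mem_Icc, eq_iff_iff]
  exact exists_congr fun r => and_comm

theorem approxProb_mono (p : Prog ℝ) {b b' : ℕ} (h : b ≤ b') (ε : ℝ) :
    p.toAlgorithm.approxProb G b (1 + ε) ≤ p.toAlgorithm.approxProb G b' (1 + ε) := by
  rw [approxProb_eq_expect, approxProb_eq_expect]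
  exact Prog.expect_run_mono _ _ (by simp) _ h

theorem lt_approxProb {ε : ℝ} (hε : 0 < ε) (hε1 : ε < 1) :
    99 / 100 < (avgDegreeProg V.card ε).toAlgorithm.approxProb G
      ⌊6000000000 * Real.log V.card ^ 3 * (ε ^ 2)⁻¹ *
        min G.avgDegree ((V.card / G.avgDegree) ^ (1 / 3 : ℝ))⌋₊ (1 + ε) := by
  classical
  have h2 := G.two_le_card
  have hd1 := G.one_le_avgDegree
  have hdn := G.avgDegree_lt_card
  set n := V.card with hn
  set d := G.avgDegree with hd
  set l := numLevels n with hl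
  set T := testThreshold n ε with hT
  set M := min d ((n / d) ^ (1 / 3 : ℝ)) with hM
  have hlog : (l : ℝ) ≤ 3 * Real.log n := numLevels_le h2
  have hl1 : (1 : ℝ) ≤ l := by
    have : 1 ≤ l := Nat.le_add_left _ _
    exact_mod_cast this
  have hTdef : T = 6401 * ((l + 1) * (2 * l + 3)) / ε ^ 2 := rfl
  have hT1 : 1 ≤ T := by
    rw [hTdef, le_div_iff₀ (by positivity)]
    nlinarith
  have hnl : n < 2 ^ l := Nat.lt_pow_succ_log_self (by norm_num) n
  have hd0 : 0 < d := by linarith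
  have hM1 : 1 ≤ M := by
    refine le_min hd1 (Real.one_le_rpow ?_ (by norm_num))
    rw [le_div_iff₀ hd0]
    linarith
  -- Level `a + 1` is the first whose budget `2 ^ (a + 1)` exceeds `M`; it is at most `2 M`, hence
  -- at most `2 d`.
  obtain ⟨a, ha1, ha2⟩ := exists_nat_pow_near hM1 (show (1 : ℝ) < 2 by norm_num)
  have hal : a < l := by
    have h3 : (2 : ℝ) ^ a < 2 ^ l :=
      calc (2 : ℝ) ^ a ≤ M := ha1
        _ ≤ d := min_le_left _ _
        _ ≤ n := hdn.le
        _ < 2 ^ l := by exact_mod_cast hnl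
    exact (pow_lt_pow_iff_right₀ (by norm_num)).1 h3
  have hB : (2 : ℝ) ^ (a + 1) ≤ 2 * M := by rw [pow_succ]; linarith
  obtain ⟨t, ht, hacc⟩ := G.exists_trial hε hε1 (zero_lt_one.trans_le hT1) (l := l) (j := a + 1)
    hnl h2 (by
      rcases min_cases d ((n / d) ^ (1 / 3 : ℝ)) with ⟨h, -⟩ | ⟨h, -⟩
      · left; rw [hM, h] at ha2; exact ha2.le
      · right
        rw [hM, h] at ha2
        rw [← div_le_iff₀ hd0]
        exact le_cube_of_rpow_third_le (div_nonneg (Nat.cast_nonneg _) hd0.le) ha2.le)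
    (hB.trans (by linarith [min_le_left d ((n / d) ^ (1 / 3 : ℝ))]))
  -- Only the levels up to `a + 1` are charged; what the later ones do is irrelevant.
  have hsplit : List.range (l + 1) =
      List.range (a + 2) ++ (List.range (l - a - 1)).map (a + 2 + ·) := by
    rw [← List.range_add]
    congr 1
    omega
  have hrun := Prog.one_le_expect_run_firstSome G.oracle (avgDegreeProg n ε) (prog n T) (cost T)
    (G.approxSet ε) _ (((List.range (l - a - 1)).map (a + 2 + ·)).flatMap (level l)) t hacc
    ((List.range (a + 2)).flatMap (level l))
    (List.mem_flatMap.2 ⟨a + 1, by simp, ht⟩)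
    (fun i _ => costLE_prog n T i)
    (fun i _ => (G.expect_prog_bad_le hε hε1 (zero_lt_one.trans_le hT1) i).1)
  rw [← List.flatMap_append, ← hsplit] at hrun
  have hmain : Prog.firstSome (prog n T) ((List.range (l + 1)).flatMap (level l)) =
    (avgDegreeProg n ε).toAlgorithm.init := rfl
  erw [hmain, ← approxProb_eq_expect] at hrun
  have hcost : (((List.range (a + 2)).flatMap (level l)).map (cost T)).sum ≤
      ⌊6000000000 * Real.log n ^ 3 * (ε ^ 2)⁻¹ * M⌋₊ := by
    apply Nat.le_floor
    refine (sum_cost_flatMap_level hT1 l (a + 2)).trans ?_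
    have hB2 : (2 : ℝ) ^ (a + 2) ≤ 4 * M := by rw [pow_succ]; linarith
    calc (2 * (l : ℝ) + 3) * (170 * T * 2 ^ (a + 2))
        ≤ (5 * l) * (170 * (6401 * ((2 * l) * (5 * l)) / ε ^ 2) * (4 * M)) := by
          rw [hTdef]
          gcongr <;> linarith
      _ = 217634000 * (l : ℝ) ^ 3 * (ε ^ 2)⁻¹ * M := by rw [div_eq_mul_inv]; ring
      _ ≤ 217634000 * (3 * Real.log n) ^ 3 * (ε ^ 2)⁻¹ * M := by gcongr
      _ = 5876118000 * Real.log n ^ 3 * (ε ^ 2)⁻¹ * M := by ring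
      _ ≤ _ := by
          have : 0 ≤ Real.log n := Real.log_natCast_nonneg n
          gcongr
          norm_num
  refine lt_of_lt_of_le ?_ (G.approxProb_mono _ hcost ε)
  set P := (avgDegreeProg n ε).toAlgorithm.approxProb G
    (((List.range (a + 2)).flatMap (level l)).map (cost T)).sum (1 + ε)
  -- Union bound: at most `(l + 1) (2 l + 3)` trials, each failing with probability at most `64 /
  -- (ε² T)`. The constant 6401 in `testThreshold` makes the total less than `1 / 100`.
  have hlen : ((((List.range (a + 2)).flatMap (level l)).length : ℕ) : ℝ≥0∞) *
      ENNReal.ofReal (4 / ((ε / 4) ^ 2 * T)) ≤ ENNReal.ofReal (64 / 6401) := by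
    rw [← ENNReal.ofReal_natCast, ← ENNReal.ofReal_mul (by positivity), length_flatMap_level]
    apply ENNReal.ofReal_le_ofReal
    have ha' : ((a + 2 : ℕ) : ℝ) ≤ l + 1 := by
      have : a + 2 ≤ l + 1 := by omega
      exact_mod_cast this
    rw [Nat.cast_mul]
    have hW : ((a + 2 : ℕ) : ℝ) * ((2 * l + 3 : ℕ) : ℝ) ≤ (l + 1) * (2 * l + 3) := by
      push_cast at ha' ⊢
      gcongr
    calc _ ≤ ((l : ℝ) + 1) * (2 * l + 3) * (4 / ((ε / 4) ^ 2 * T)) := by gcongr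
      _ = 64 / 6401 := by
          rw [hTdef]
          field_simp
          norm_num
  have hfin := hrun.trans (add_le_add le_rfl hlen)
  by_contra hcon
  push Not at hcon
  have h99 : (99 / 100 : ℝ≥0∞) = ENNReal.ofReal (99 / 100) := by
    rw [ENNReal.ofReal_div_of_pos (by norm_num)]; norm_num
  have := hfin.trans (add_le_add hcon le_rfl)
  rw [h99, ← ENNReal.ofReal_add (by norm_num) (by norm_num), ← ENNReal.ofReal_one,
    ENNReal.ofReal_le_ofReal_iff (by norm_num)] at this
  norm_num at this

end InputGraph

/-- The upper bound. -/
theorem exists_avgDegree_algorithm :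
    ∃ (A : ℕ → ℝ → QueryAlgorithm) (C : ℝ) (k : ℕ), 0 < C ∧
      ∀ (n : ℕ) (ε : ℝ), 0 < ε → ε < 1 →
        ∀ (V : Finset ℕ), V.card = n → ∀ G : InputGraph V,
          99 / 100 < (A n ε).approxProb G
            ⌊C * Real.log n ^ k * (ε ^ 2)⁻¹ *
              min G.avgDegree ((n / G.avgDegree) ^ (1 / 3 : ℝ))⌋₊ (1 + ε) ∧
          99 / 100 < (A n ε).approxProb G
            ⌊C * Real.log n ^ k * (ε ^ 2)⁻¹ * (n : ℝ) ^ (1 / 4 : ℝ)⌋₊ (1 + ε) := by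
  refine ⟨fun n ε => (avgDegreeProg n ε).toAlgorithm, 6000000000, 3, by norm_num, ?_⟩
  rintro n ε hε hε1 V rfl G
  have h := G.lt_approxProb hε hε1
  refine ⟨h, h.trans_le (G.approxProb_mono _ (Nat.floor_mono ?_) ε)⟩
  have hlog : 0 ≤ Real.log V.card := Real.log_natCast_nonneg _
  have hn : (1 : ℝ) ≤ V.card := by exact_mod_cast G.card_pos
  exact mul_le_mul_of_nonneg_left (min_le_rpow_quarter G.one_le_avgDegree hn) (by positivity)


/-! ### Uniformly random labelings with prescribed class sizes. -/

section Labelings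

variable {α L : Type*} [Fintype α] [DecidableEq α] [Fintype L] [DecidableEq L] (size : L → ℕ)

/-- The labelings with prescribed class sizes that extend a partial labeling. -/
def labelings (D : Finset α) (ℓ : α → L) : Finset (α → L) :=
  {lam | (∀ a, (Finset.univ.filter fun v => lam v = a).card = size a) ∧ ∀ u ∈ D, lam u = ℓ u}

theorem mem_labelings {D : Finset α} {ℓ lam : α → L} :
    lam ∈ labelings size D ℓ ↔
      (∀ a, (Finset.univ.filter fun v => lam v = a).card = size a) ∧ ∀ u ∈ D, lam u = ℓ u := by
  simp [labelings]

theorem labelings_congr {D : Finset α} {ℓ ℓ' : α → L} (h : ∀ u ∈ D, ℓ u = ℓ' u) :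
    labelings size D ℓ = labelings size D ℓ' := by
  ext lam
  simp only [mem_labelings]
  exact and_congr_right fun _ => forall₂_congr fun u hu => by rw [h u hu]

theorem filter_labelings {D : Finset α} {y : α} (hy : y ∉ D) (ℓ : α → L) (a : L) :
    (labelings size D ℓ).filter (fun lam => lam y = a) =
      labelings size (insert y D) (Function.update ℓ y a) := by
  ext lam
  simp only [Finset.mem_filter, mem_labelings, Finset.forall_mem_insert, Function.update_self]
  constructor
  · rintro ⟨⟨h1, h2⟩, h3⟩
    refine ⟨h1, h3, fun u hu => ?_⟩
    rw [Function.update_of_ne (ne_of_mem_of_not_mem hu hy), h2 u hu]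
  · rintro ⟨h1, h3, h2⟩
    refine ⟨⟨h1, fun u hu => ?_⟩, h3⟩
    rw [h2 u hu, Function.update_of_ne (ne_of_mem_of_not_mem hu hy)]

/-- Unseen points are exchangeable: precomposing with the swap of `y` and `z` preserves class sizes
and the values on `D`. -/
theorem card_filter_labelings_eq {D : Finset α} {y z : α} (hy : y ∉ D) (hz : z ∉ D)
    (ℓ : α → L) (a : L) :
    ((labelings size D ℓ).filter fun lam => lam y = a).card =
      ((labelings size D ℓ).filter fun lam => lam z = a).card := by
  have key : ∀ {y z : α}, y ∉ D → z ∉ D → ∀ lam ∈ (labelings size D ℓ).filter (fun lam => lam y = a),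
      lam ∘ Equiv.swap y z ∈ (labelings size D ℓ).filter (fun lam => lam z = a) := by
    intro y z hy hz lam h
    simp only [Finset.mem_filter, mem_labelings, Function.comp_apply] at h ⊢
    refine ⟨⟨fun b => ?_, fun u hu => ?_⟩, by simp [h.2]⟩
    · rw [← h.1.1 b]
      exact Finset.card_equiv (Equiv.swap y z) (by simp)
    · rw [Equiv.swap_apply_of_ne_of_ne (ne_of_mem_of_not_mem hu hy) (ne_of_mem_of_not_mem hu hz),
        h.1.2 u hu]
  refine Finset.card_nbij' (fun lam => lam ∘ Equiv.swap y z) (fun lam => lam ∘ Equiv.swap z y)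
    (key hy hz) (key hz hy) ?_ ?_
  · intro lam _
    funext v
    simp [Equiv.swap_comm z y]
  · intro lam _
    funext v
    simp [Equiv.swap_comm z y]

/-- Double counting of unseen points with label `a`: each labeling has as many as the class has
places left, and each unseen point occurs equally often. The truncated subtraction is harmless,
because an overfull class admits no labeling. -/
theorem card_labelings_insert {D : Finset α} {y : α} (hy : y ∉ D) (ℓ : α → L) (a : L) :
    (labelings size (insert y D) (Function.update ℓ y a)).card * (Fintype.card α - D.card) =
      (size a - (D.filter fun u => ℓ u = a).card) * (labelings size D ℓ).card := by
  rw [← filter_labelings size hy, ← Finset.card_compl]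
  have h1 : ∑ z ∈ Dᶜ, ((labelings size D ℓ).filter fun lam => lam z = a).card =
      Dᶜ.card * ((labelings size D ℓ).filter fun lam => lam y = a).card := by
    rw [← smul_eq_mul, ← Finset.sum_const]
    exact Finset.sum_congr rfl fun z hz =>
      card_filter_labelings_eq size (by simpa using hz) hy ℓ a
  rw [mul_comm, ← h1]
  simp only [Finset.card_filter]
  rw [Finset.sum_comm, mul_comm, ← smul_eq_mul, ← Finset.sum_const]
  refine Finset.sum_congr rfl fun lam hlam => ?_
  rw [mem_labelings] at hlam
  have h2 := Finset.sum_add_sum_compl D fun v => if lam v = a then 1 else 0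
  have h3 := hlam.1 a
  rw [Finset.card_filter] at h3
  have h4 : (∑ i ∈ D, if ℓ i = a then 1 else 0) = ∑ i ∈ D, if lam i = a then 1 else 0 :=
    Finset.sum_congr rfl fun u hu => by rw [hlam.2 u hu]
  rw [← h3, ← h2, h4, Nat.add_sub_cancel_left]

theorem labelings_empty_nonempty (h : ∑ a, size a = Fintype.card α) (ℓ : α → L) :
    (labelings size ∅ ℓ).Nonempty := by
  have hcard : Fintype.card α = Fintype.card (Σ a : L, Fin (size a)) := by simp [h]
  let e := Fintype.equivOfCardEq hcard
  refine ⟨fun v => (e v).1, ?_⟩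
  rw [mem_labelings]
  refine ⟨fun a => ?_, by simp⟩
  have h2 : (Finset.univ.filter fun x : Σ a : L, Fin (size a) => x.1 = a).card = size a := by
    have : (Finset.univ.filter fun x : Σ a : L, Fin (size a) => x.1 = a) =
        Finset.univ.map (Function.Embedding.sigmaMk a) := by
      ext ⟨b, i⟩
      simp only [Finset.mem_filter, Finset.mem_univ, true_and, Finset.mem_map,
        Function.Embedding.sigmaMk_apply]
      constructor
      · rintro rfl; exact ⟨i, rfl⟩
      · rintro ⟨j, hj⟩; exact (congrArg Sigma.fst hj).symm
    rw [this, Finset.card_map, Finset.card_univ, Fintype.card_fin]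
  rw [← h2]
  exact Finset.card_equiv e (by simp)

/-- While `D` is smaller than every class, no class is full, so by `card_labelings_insert` the
number of extensions stays positive. -/
theorem labelings_nonempty (h : ∑ a, size a = Fintype.card α) (D : Finset α) (ℓ : α → L)
    (hD : ∀ a, D.card ≤ size a) : (labelings size D ℓ).Nonempty := by
  induction D using Finset.induction_on with
  | empty => exact labelings_empty_nonempty size h ℓ
  | insert y D hy ih =>
    have hD' : ∀ a, D.card < size a := fun a =>
      (Finset.card_lt_card (Finset.ssubset_insert hy)).trans_le (hD a)
    have hpos := (ih fun a => (hD' a).le).card_pos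
    have hins := card_labelings_insert size hy ℓ (ℓ y)
    rw [Function.update_eq_self] at hins
    have hr : (D.filter fun u => ℓ u = ℓ y).card < size (ℓ y) :=
      (Finset.card_filter_le _ _).trans_lt (hD' _)
    have : 0 < (size (ℓ y) - (D.filter fun u => ℓ u = ℓ y).card) * (labelings size D ℓ).card :=
      Nat.mul_pos (by omega) hpos
    rw [← hins] at this
    exact Finset.card_pos.1 (Nat.pos_of_mul_pos_right this)

/-- The average of a function over the labelings that extend a partial labeling. -/
def labelAvg (D : Finset α) (ℓ : α → L) (F : (α → L) → ℝ≥0∞) : ℝ≥0∞ :=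
  ((labelings size D ℓ).card : ℝ≥0∞)⁻¹ * ∑ lam ∈ labelings size D ℓ, F lam

/-- The exact coefficient subtracts only the seen points labeled `a`. Subtracting all of `D.card`
makes it independent of `ℓ`, so it can be taken out of averages over `ℓ`. -/
theorem labelAvg_insert_le {D : Finset α} {y : α} (hy : y ∉ D) (ℓ : α → L) (a : L)
    (F : (α → L) → ℝ≥0∞) :
    ((size a - D.card : ℕ) : ℝ≥0∞) * ((Fintype.card α - D.card : ℕ) : ℝ≥0∞)⁻¹ *
        labelAvg size (insert y D) (Function.update ℓ y a) F ≤
      labelAvg size D ℓ fun lam => if lam y = a then F lam else 0 := by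
  have hins := card_labelings_insert size hy ℓ a
  rw [labelAvg, labelAvg, ← Finset.sum_filter, filter_labelings size hy, ← mul_assoc]
  gcongr
  set m' := (labelings size (insert y D) (Function.update ℓ y a)).card
  set m := (labelings size D ℓ).card
  have hr : (D.filter fun u => ℓ u = a).card ≤ D.card := Finset.card_filter_le _ _
  set r := (D.filter fun u => ℓ u = a).card
  have hN : Fintype.card α - D.card ≠ 0 := by
    have : D.card < Fintype.card α := Finset.card_lt_univ_of_notMem hy
    omega
  set N := Fintype.card α - D.card
  -- If no extension exists, the inverse of the count is `⊤` and the coefficient must be shown to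
  -- vanish separately.
  rcases Nat.eq_zero_or_pos m' with h0 | h0
  · have h1 : (size a - r) * m = 0 := by rw [← hins, h0, zero_mul]
    rcases Nat.mul_eq_zero.1 h1 with h2 | h2
    · have : size a - D.card = 0 := by omega
      simp [this]
    · simp [h2]
  · rw [mul_assoc, ← ENNReal.mul_inv (by simp [hN]) (by simp), ENNReal.le_inv_iff_mul_le]
    rw [mul_right_comm, ← div_eq_mul_inv]
    apply ENNReal.div_le_of_le_mul
    rw [one_mul]
    have : (size a - D.card) * m ≤ N * m' := by
      rw [mul_comm N, hins]
      exact Nat.mul_le_mul_right _ (by omega)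
    exact_mod_cast this

theorem labelAvg_mono {D : Finset α} {ℓ : α → L} {F F' : (α → L) → ℝ≥0∞}
    (h : ∀ lam ∈ labelings size D ℓ, F lam ≤ F' lam) :
    labelAvg size D ℓ F ≤ labelAvg size D ℓ F' := by
  unfold labelAvg
  gcongr with lam hlam
  exact h lam hlam

theorem labelAvg_expect {β : Type*} (p : PMF β) (D : Finset α) (ℓ : α → L)
    (F : β → (α → L) → ℝ≥0∞) :
    labelAvg size D ℓ (fun lam => p.expect fun b => F b lam) =
      p.expect fun b => labelAvg size D ℓ (F b) := by
  simp only [labelAvg, PMF.expect_const_mul, PMF.expect_sum]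

theorem labelAvg_const_mul (c : ℝ≥0∞) (D : Finset α) (ℓ : α → L) (F : (α → L) → ℝ≥0∞) :
    labelAvg size D ℓ (fun lam => c * F lam) = c * labelAvg size D ℓ F := by
  simp only [labelAvg, ← Finset.mul_sum, mul_left_comm]

theorem labelAvg_sum {β : Type*} (s : Finset β) (D : Finset α) (ℓ : α → L)
    (F : β → (α → L) → ℝ≥0∞) :
    labelAvg size D ℓ (fun lam => ∑ b ∈ s, F b lam) = ∑ b ∈ s, labelAvg size D ℓ (F b) := by
  simp only [labelAvg, Finset.mul_sum]
  exact Finset.sum_comm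

theorem labelAvg_const_le (D : Finset α) (ℓ : α → L) (c : ℝ≥0∞) :
    labelAvg size D ℓ (fun _ => c) ≤ c := by
  rw [labelAvg, Finset.sum_const, nsmul_eq_mul, ← mul_assoc]
  exact mul_le_of_le_one_left zero_le (by rw [mul_comm]; exact ENNReal.mul_inv_le_one _)

theorem labelAvg_const {D : Finset α} {ℓ : α → L} (h : (labelings size D ℓ).Nonempty) (c : ℝ≥0∞) :
    labelAvg size D ℓ (fun _ => c) = c := by
  rw [labelAvg, Finset.sum_const, nsmul_eq_mul, ← mul_assoc,
    ENNReal.inv_mul_cancel (by simp [h.card_pos.ne']) (by simp), one_mul]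

end Labelings


/-- Resampling one coordinate preserves the uniform measure: exchanging `f u` with the new value `b`
is an involution. -/
theorem sum_sum_update {α β M : Type*} [Fintype α] [DecidableEq α] [Fintype β] [AddCommMonoid M]
    (u : α) (g : (α → β) → M) :
    ∑ f : α → β, ∑ b, g (Function.update f u b) = Fintype.card β • ∑ f, g f := by
  let e : (α → β) × β ≃ (α → β) × β :=
    { toFun := fun p => (Function.update p.1 u p.2, p.1 u)
      invFun := fun p => (Function.update p.1 u p.2, p.1 u)
      left_inv := fun p => by simp
      right_inv := fun p => by simp }
  calc ∑ f : α → β, ∑ b, g (Function.update f u b)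
      = ∑ p : (α → β) × β, g (e p).1 := by rw [Fintype.sum_prod_type]; rfl
    _ = ∑ p : (α → β) × β, g p.1 := e.sum_comp fun p => g p.1
    _ = _ := by rw [Fintype.sum_prod_type]; simp [Finset.smul_sum]

theorem card_filter_apply_eq {α β : Type*} [Fintype α] [DecidableEq α] [Fintype β] [DecidableEq β]
    {a b : α} (h : a ≠ b) :
    Fintype.card β * (Finset.univ.filter fun f : α → β => f a = f b).card =
      Fintype.card (α → β) := by
  have := sum_sum_update a fun f : α → β => if f a = f b then 1 else 0
  rw [← Finset.card_filter, smul_eq_mul] at this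
  rw [← this]
  simp [Function.update_of_ne h.symm]

/-! ### Hidden cliques behind independent random handles. -/

section HiddenLabels

variable {α : Type*} [Fintype α] [DecidableEq α] (t s : ℕ)

/-- The class sizes of a labeling by `t` cliques of size `s` each. -/
def cliqueSize (N : ℕ) : Option (Fin t) → ℕ
  | none => N - t * s
  | some _ => s

/-- The average over the hidden labelings that are compatible with the vertices seen so far: the
set `D` of seen vertices is divided into low vertices and vertices that lie in cliques with known
handles, and distinct handles may refer to the same clique. -/
def hiddenAvg (D : Finset α) (τ : α → Option α) (F : (α → Option (Fin t)) → ℝ≥0∞) : ℝ≥0∞ :=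
  (Fintype.card (α → Fin t) : ℝ≥0∞)⁻¹ * ∑ φ : α → Fin t,
    labelAvg (cliqueSize t s (Fintype.card α)) D (fun u => (τ u).map φ) F

variable {t s} {D : Finset α} {τ : α → Option α}

/-- The hypotheses on `lam` are what the seen vertices reveal. Equal handles force equal labels, but
distinct handles force nothing. -/
theorem hiddenAvg_mono {F F' : (α → Option (Fin t)) → ℝ≥0∞}
    (h : ∀ lam, (∀ a, (Finset.univ.filter fun v => lam v = a).card =
        cliqueSize t s (Fintype.card α) a) →
      (∀ u ∈ D, τ u = none → lam u = none) →
      (∀ u ∈ D, τ u ≠ none → lam u ≠ none) →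
      (∀ u ∈ D, ∀ v ∈ D, τ u = τ v → lam u = lam v) → F lam ≤ F' lam) :
    hiddenAvg t s D τ F ≤ hiddenAvg t s D τ F' := by
  unfold hiddenAvg
  gcongr with φ
  refine labelAvg_mono _ fun lam hlam => ?_
  rw [mem_labelings] at hlam
  refine h lam hlam.1 (fun u hu h0 => by simp [hlam.2 u hu, h0])
    (fun u hu h0 => ?_) (fun u hu v hv huv => by rw [hlam.2 u hu, hlam.2 v hv, huv])
  simpa [hlam.2 u hu] using h0

theorem hiddenAvg_expect {β : Type*} (p : PMF β) (F : β → (α → Option (Fin t)) → ℝ≥0∞) :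
    hiddenAvg t s D τ (fun lam => p.expect fun b => F b lam) =
      p.expect fun b => hiddenAvg t s D τ (F b) := by
  simp only [hiddenAvg, labelAvg_expect, PMF.expect_const_mul, PMF.expect_sum]

theorem hiddenAvg_const_mul (c : ℝ≥0∞) (F : (α → Option (Fin t)) → ℝ≥0∞) :
    hiddenAvg t s D τ (fun lam => c * F lam) = c * hiddenAvg t s D τ F := by
  simp only [hiddenAvg, labelAvg_const_mul, ← Finset.mul_sum, mul_left_comm]

theorem hiddenAvg_sum {β : Type*} (S : Finset β) (F : β → (α → Option (Fin t)) → ℝ≥0∞) :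
    hiddenAvg t s D τ (fun lam => ∑ b ∈ S, F b lam) = ∑ b ∈ S, hiddenAvg t s D τ (F b) := by
  simp only [hiddenAvg, labelAvg_sum]
  rw [Finset.sum_comm, Finset.mul_sum]

theorem hiddenAvg_const_le (c : ℝ≥0∞) : hiddenAvg t s D τ (fun _ => c) ≤ c := by
  calc hiddenAvg t s D τ (fun _ => c)
      ≤ (Fintype.card (α → Fin t) : ℝ≥0∞)⁻¹ * ∑ _φ : α → Fin t, c := by
        unfold hiddenAvg
        gcongr
        exact labelAvg_const_le _ _ _ _
    _ ≤ c := by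
        rw [Finset.sum_const, nsmul_eq_mul, ← mul_assoc, Finset.card_univ]
        exact mul_le_of_le_one_left zero_le (by rw [mul_comm]; exact ENNReal.mul_inv_le_one _)

theorem hiddenAvg_le_one {F : (α → Option (Fin t)) → ℝ≥0∞} (hF : ∀ lam, F lam ≤ 1) :
    hiddenAvg t s D τ F ≤ 1 :=
  (hiddenAvg_mono fun lam _ _ _ _ => hF lam).trans (hiddenAvg_const_le 1)

/-- With few seen vertices every choice of handles is realized by some labeling, so no term is an
empty average, whose value would be 0. -/
theorem hiddenAvg_const (ht : 0 < t) (hN : t * s ≤ Fintype.card α) (hs : D.card ≤ s)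
    (hl : D.card ≤ Fintype.card α - t * s) (c : ℝ≥0∞) : hiddenAvg t s D τ (fun _ => c) = c := by
  have hne : ∀ ℓ, (labelings (cliqueSize t s (Fintype.card α)) D ℓ).Nonempty := by
    refine fun ℓ => labelings_nonempty _ ?_ D ℓ ?_
    · simp only [cliqueSize, Fintype.sum_option, Finset.sum_const, Finset.card_univ,
        Fintype.card_fin, smul_eq_mul]
      omega
    · rintro (_ | a)
      · exact hl
      · exact hs
  have : Nonempty (Fin t) := ⟨⟨0, ht⟩⟩
  simp only [hiddenAvg, labelAvg_const _ (hne _)]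
  rw [Finset.sum_const, nsmul_eq_mul, ← mul_assoc, Finset.card_univ,
    ENNReal.inv_mul_cancel (Nat.cast_ne_zero.2 Fintype.card_ne_zero) (by simp), one_mul]

/-- An unseen vertex is likely to be low. -/
theorem hiddenAvg_insert_low_le {y : α} (hy : y ∉ D) (F : (α → Option (Fin t)) → ℝ≥0∞) :
    ((Fintype.card α - t * s - D.card : ℕ) : ℝ≥0∞) * ((Fintype.card α - D.card : ℕ) : ℝ≥0∞)⁻¹ *
      hiddenAvg t s (insert y D) (Function.update τ y none) F ≤ hiddenAvg t s D τ F := by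
  unfold hiddenAvg
  rw [mul_left_comm, Finset.mul_sum]
  gcongr with φ
  have h := labelAvg_insert_le (cliqueSize t s (Fintype.card α)) hy (fun u => (τ u).map φ) none F
  have hup : (fun u => (Function.update τ y none u).map φ) =
      Function.update (fun u => (τ u).map φ) y none := by
    funext u
    by_cases hu : u = y
    · subst hu; simp
    · simp [Function.update_of_ne hu]
  rw [hup]
  refine h.trans (labelAvg_mono _ fun lam _ => ?_)
  split_ifs
  · exact le_rfl
  · exact zero_le

theorem hiddenAvg_insert_clique_le {x y a : α} (hx : x ∈ D) (hxa : τ x = some a) (hy : y ∉ D)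
    (F : (α → Option (Fin t)) → ℝ≥0∞) :
    ((s - D.card : ℕ) : ℝ≥0∞) * ((Fintype.card α - D.card : ℕ) : ℝ≥0∞)⁻¹ *
      hiddenAvg t s (insert y D) (Function.update τ y (some a)) F ≤
    hiddenAvg t s D τ fun lam => if lam y = lam x then F lam else 0 := by
  unfold hiddenAvg
  rw [mul_left_comm, Finset.mul_sum]
  gcongr with φ
  have h := labelAvg_insert_le (cliqueSize t s (Fintype.card α)) hy (fun u => (τ u).map φ)
    (some (φ a)) F
  have hup : (fun u => (Function.update τ y (some a) u).map φ) =
      Function.update (fun u => (τ u).map φ) y (some (φ a)) := by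
    funext u
    by_cases hu : u = y
    · subst hu; simp
    · simp [Function.update_of_ne hu]
  rw [hup]
  refine h.trans (labelAvg_mono _ fun lam hlam => ?_)
  rw [((mem_labelings _).1 hlam).2 x hx, hxa, Option.map_some]

/-- Both unseen vertices may lie in any of the `t` cliques, whence the factor `t`. Summing over
these cliques amounts to averaging over the value of `φ` at the new handle `u`. -/
theorem hiddenAvg_insert_edge_le {u v : α} (hu : u ∉ D) (hv : v ∉ insert u D)
    (hτ : ∀ x ∈ D, τ x ≠ some u) (F : (α → Option (Fin t)) → ℝ≥0∞) :
    (t : ℝ≥0∞) * (((s - D.card : ℕ) : ℝ≥0∞) * ((Fintype.card α - D.card : ℕ) : ℝ≥0∞)⁻¹ *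
      (((s - (insert u D).card : ℕ) : ℝ≥0∞) *
        ((Fintype.card α - (insert u D).card : ℕ) : ℝ≥0∞)⁻¹)) *
      hiddenAvg t s (insert v (insert u D))
        (Function.update (Function.update τ u (some u)) v (some u)) F ≤
    hiddenAvg t s D τ fun lam => if lam u = lam v ∧ lam u ≠ none then F lam else 0 := by
  set c₁ := ((s - D.card : ℕ) : ℝ≥0∞) * ((Fintype.card α - D.card : ℕ) : ℝ≥0∞)⁻¹
  set c₂ := ((s - (insert u D).card : ℕ) : ℝ≥0∞) *
    ((Fintype.card α - (insert u D).card : ℕ) : ℝ≥0∞)⁻¹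
  set sz := cliqueSize t s (Fintype.card α)
  set τ' := Function.update (Function.update τ u (some u)) v (some u)
  have hvu : v ≠ u := fun h => hv (h ▸ Finset.mem_insert_self _ _)
  have key : ∀ φ : α → Fin t, ∑ j : Fin t, c₁ * c₂ * labelAvg sz (insert v (insert u D))
      (fun x => (τ' x).map (Function.update φ u j)) F ≤
      labelAvg sz D (fun x => (τ x).map φ)
        fun lam => if lam u = lam v ∧ lam u ≠ none then F lam else 0 := by
    intro φ
    calc _ ≤ ∑ j : Fin t, labelAvg sz D (fun x => (τ x).map φ) (fun lam =>
          if lam u = some j then (if lam v = some j then F lam else 0) else 0) := by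
          refine Finset.sum_le_sum fun j _ => ?_
          refine le_trans ?_ (labelAvg_insert_le sz hu (fun x => (τ x).map φ) (some j) _)
          rw [mul_assoc]
          refine mul_le_mul_right ?_ c₁
          refine le_trans (le_of_eq ?_) (labelAvg_insert_le sz hv _ (some j) F)
          congr 1
          unfold labelAvg
          rw [labelings_congr]
          intro x hx
          simp only [Finset.mem_insert] at hx
          rcases hx with rfl | rfl | hx
          · simp [τ']
          · simp [τ', Function.update_of_ne hvu.symm]
          · have h1 : x ≠ u := ne_of_mem_of_not_mem hx hu
            have h2 : x ≠ v := ne_of_mem_of_not_mem (Finset.mem_insert_of_mem hx) hv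
            simp only [τ', Function.update_of_ne h1, Function.update_of_ne h2]
            rcases hx' : τ x with _ | z
            · rfl
            -- No seen vertex uses the handle `u`, so changing `φ u` leaves the old labels alone.
            · have : z ≠ u := fun h => hτ x hx (h ▸ hx')
              simp [Function.update_of_ne this]
      _ = _ := by
          rw [← labelAvg_sum]
          congr 1
          funext lam
          rcases hlu : lam u with _ | i
          · simp
          · by_cases h : lam v = some i
            · simp [h]
            · have h' : ¬ some i = lam v := fun h' => h h'.symm
              simp [h, h']
  unfold hiddenAvg
  calc _ = (Fintype.card (α → Fin t) : ℝ≥0∞)⁻¹ * (c₁ * c₂ * (Fintype.card (Fin t) •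
        ∑ φ : α → Fin t, labelAvg sz (insert v (insert u D)) (fun x => (τ' x).map φ) F)) := by
        rw [Fintype.card_fin, nsmul_eq_mul]; ring
    _ ≤ _ := by
        gcongr
        rw [← sum_sum_update u fun φ : α → Fin t =>
          labelAvg sz (insert v (insert u D)) (fun x => (τ' x).map φ) F, Finset.mul_sum]
        refine Finset.sum_le_sum fun φ _ => ?_
        rw [Finset.mul_sum]
        exact key φ

/-- Distinct handles are likely to refer to distinct cliques. -/
theorem hiddenAvg_le_add_inv {x y a b : α} (hx : x ∈ D) (hy : y ∈ D) (hxa : τ x = some a)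
    (hyb : τ y = some b) (hab : a ≠ b) {F : (α → Option (Fin t)) → ℝ≥0∞} (hF : ∀ lam, F lam ≤ 1) :
    hiddenAvg t s D τ F ≤
      hiddenAvg t s D τ (fun lam => if lam x ≠ lam y then F lam else 0) + (t : ℝ≥0∞)⁻¹ := by
  rcases Nat.eq_zero_or_pos t with ht | ht
  · simp [ht]
  have : Nonempty (Fin t) := ⟨⟨0, ht⟩⟩
  have hcard := card_filter_apply_eq (β := Fin t) hab
  rw [Fintype.card_fin] at hcard
  have hinv : (t : ℝ≥0∞)⁻¹ = (Fintype.card (α → Fin t) : ℝ≥0∞)⁻¹ *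
      ∑ φ : α → Fin t, if φ a = φ b then 1 else 0 := by
    rw [← Finset.natCast_card_filter, ← hcard, Nat.cast_mul,
      ENNReal.mul_inv (by simp) (by simp), mul_assoc, ENNReal.inv_mul_cancel _ (by simp), mul_one]
    intro h
    rw [Nat.cast_eq_zero] at h
    rw [h, mul_zero] at hcard
    exact Fintype.card_ne_zero hcard.symm
  rw [hinv, hiddenAvg, hiddenAvg, ← mul_add, ← Finset.sum_add_distrib]
  gcongr with φ
  by_cases h : φ a = φ b
  · rw [if_pos h]
    exact ((labelAvg_mono _ fun lam _ => hF lam).trans (labelAvg_const_le _ _ _ 1)).trans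
      le_add_self
  · rw [if_neg h, add_zero]
    refine labelAvg_mono _ fun lam hlam => ?_
    have hl := ((mem_labelings _).1 hlam).2
    rw [if_pos]
    rw [hl x hx, hl y hy, hxa, hyb]
    simpa using h

end HiddenLabels


/-! ### The hard graphs: a hub and disjoint cliques. -/

section CliqueGraph

variable {V : Finset ℕ} {t : ℕ}

/-- The graph in which a hub is adjacent to all vertices and each label class is a clique. -/
def cliqueGraph (hV : 2 ≤ V.card) (h : V) (lam : V → Option (Fin t)) : InputGraph V where
  nonempty := ⟨h, h.2⟩
  graph :=
    { Adj := fun u v => u ≠ v ∧ (u = h ∨ v = h ∨ (lam u = lam v ∧ lam u ≠ none))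
      symm := ⟨by
        rintro u v ⟨h1, h2 | h2 | ⟨h2, h3⟩⟩
        · exact ⟨h1.symm, Or.inr (Or.inl h2)⟩
        · exact ⟨h1.symm, Or.inl h2⟩
        · exact ⟨h1.symm, Or.inr (Or.inr ⟨h2.symm, h2 ▸ h3⟩)⟩⟩
      loopless := ⟨fun _ hu => hu.1 rfl⟩ }
  exists_adj := by
    intro v
    by_cases hv : v = h
    · obtain ⟨w, hw⟩ : ∃ w : V, w ≠ v := by
        have : Nontrivial V := Fintype.one_lt_card_iff_nontrivial.1 (by
          rw [Fintype.card_coe]; omega)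
        exact exists_ne v
      exact ⟨w, hw.symm, Or.inl hv⟩
    · exact ⟨h, hv, Or.inr (Or.inl rfl)⟩

variable {hV : 2 ≤ V.card} {h : V} {lam : V → Option (Fin t)}

theorem cliqueGraph_adj {u v : V} : (cliqueGraph hV h lam).graph.Adj u v ↔
    u ≠ v ∧ (u = h ∨ v = h ∨ (lam u = lam v ∧ lam u ≠ none)) := Iff.rfl

open scoped Classical in
theorem neighborFinset_hub :
    (cliqueGraph hV h lam).graph.neighborFinset h = Finset.univ.erase h := by
  ext v
  simp only [SimpleGraph.mem_neighborFinset, cliqueGraph_adj, Finset.mem_erase, Finset.mem_univ]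
  tauto

open scoped Classical in
theorem neighborFinset_low {v : V} (hv : v ≠ h) (hlow : lam v = none) :
    (cliqueGraph hV h lam).graph.neighborFinset v = {h} := by
  ext w
  simp only [SimpleGraph.mem_neighborFinset, cliqueGraph_adj, Finset.mem_singleton]
  constructor
  · rintro ⟨-, h1 | h1 | h1⟩
    · exact absurd h1 hv
    · exact h1
    · exact absurd hlow h1.2
  · rintro rfl
    exact ⟨hv, Or.inr (Or.inl rfl)⟩

open scoped Classical in
theorem neighborFinset_clique {v : V} (hh : lam h = none) (hv : lam v ≠ none) :
    (cliqueGraph hV h lam).graph.neighborFinset v =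
      insert h ((Finset.univ.filter fun w => lam w = lam v).erase v) := by
  have hvh : v ≠ h := fun e => hv (e ▸ hh)
  ext w
  simp only [SimpleGraph.mem_neighborFinset, cliqueGraph_adj, Finset.mem_insert, Finset.mem_erase,
    Finset.mem_filter, Finset.mem_univ, true_and]
  constructor
  · rintro ⟨h1, h2 | h2 | h2⟩
    · exact absurd h2 hvh
    · exact Or.inl h2
    · exact Or.inr ⟨h1.symm, h2.1.symm⟩
  · rintro (rfl | h1)
    · exact ⟨hvh, Or.inr (Or.inl rfl)⟩
    · exact ⟨h1.1.symm, Or.inr (Or.inr ⟨h1.2.symm, hv⟩)⟩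

theorem deg_hub : (cliqueGraph hV h lam).deg h = V.card - 1 := by
  classical
  rw [InputGraph.deg, ← SimpleGraph.card_neighborFinset_eq_degree, neighborFinset_hub,
    Finset.card_erase_of_mem (Finset.mem_univ _), Finset.card_univ, Fintype.card_coe]

theorem deg_low {v : V} (hv : v ≠ h) (hlow : lam v = none) :
    (cliqueGraph hV h lam).deg v = 1 := by
  classical
  rw [InputGraph.deg, ← SimpleGraph.card_neighborFinset_eq_degree, neighborFinset_low hv hlow,
    Finset.card_singleton]

variable {s : ℕ}

theorem deg_clique {v : V} (hh : lam h = none) (hv : lam v ≠ none) (hs : 0 < s)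
    (hsize : ∀ a, (Finset.univ.filter fun v => lam v = a).card = cliqueSize t s V.card a) :
    (cliqueGraph hV h lam).deg v = s := by
  classical
  rw [InputGraph.deg, ← SimpleGraph.card_neighborFinset_eq_degree, neighborFinset_clique hh hv,
    Finset.card_insert_of_notMem, Finset.card_erase_of_mem (by simp), hsize]
  · obtain ⟨j, hj⟩ := Option.ne_none_iff_exists'.1 hv
    rw [hj, cliqueSize]
    omega
  · simp only [Finset.mem_erase, Finset.mem_filter, Finset.mem_univ, true_and, hh]
    exact fun h1 => hv h1.2.symm

/-- The degree sum is `(n - 1) + (n - t s - 1) + t s * s`, from the hub, the other low vertices and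
the clique vertices. It is the same for all labelings with these class sizes. -/
theorem two_mul_numEdges_cliqueGraph (hh : lam h = none) (hs : 0 < s) (hts : t * s < V.card)
    (hsize : ∀ a, (Finset.univ.filter fun v => lam v = a).card = cliqueSize t s V.card a) :
    2 * (cliqueGraph hV h lam).numEdges + t * s + 2 = 2 * V.card + t * s * s := by
  classical
  rw [← InputGraph.sum_deg, ← Finset.add_sum_erase _ _ (Finset.mem_univ h), deg_hub]
  have hlow := hsize none
  rw [cliqueSize] at hlow
  set A := Finset.univ.filter fun v => lam v = none with hA
  have hhA : h ∈ A := by simp [hA, hh]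
  have hAc : Aᶜ.card = t * s := by
    rw [Finset.card_compl, hlow, Fintype.card_coe]; omega
  have hsplit : Finset.univ.erase h = (A.erase h) ∪ Aᶜ := by
    ext v
    by_cases hv : v = h
    · subst hv; simp [hhA]
    · by_cases hvA : v ∈ A <;> simp [hv, hvA]
  have hdisj : Disjoint (A.erase h) Aᶜ :=
    disjoint_compl_right.mono_left (Finset.erase_subset _ _)
  rw [hsplit, Finset.sum_union hdisj,
    Finset.sum_congr (s₁ := A.erase h) rfl (g := fun _ => 1) (fun v hv => by
      rw [Finset.mem_erase] at hv
      exact deg_low hv.1 (by simpa [hA] using hv.2)),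
    Finset.sum_congr (s₁ := Aᶜ) rfl (g := fun _ => s) (fun v hv => by
      exact deg_clique hh (by simpa [hA] using hv) hs hsize)]
  simp only [Finset.sum_const, smul_eq_mul, hAc, Finset.card_erase_of_mem hhA, hlow]
  omega

theorem expect_oracle_randVert (G : InputGraph V) (f : ℕ → ℝ≥0∞) :
    (G.oracle .randVert).expect f = (V.card : ℝ≥0∞)⁻¹ * ∑ v : V, f v := by
  rw [show G.oracle .randVert = PMF.uniformOfFinset V G.nonempty from rfl]
  erw [PMF.expect_uniformOfFinset]
  congr 1
  exact (Finset.sum_coe_sort V _).symm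

open scoped Classical in
theorem expect_oracle_randNbr (G : InputGraph V) (v : V) (f : Option ℕ → ℝ≥0∞) :
    (G.oracle (.randNbr v)).expect f =
      (G.deg v : ℝ≥0∞)⁻¹ * ∑ w ∈ G.graph.neighborFinset v, f (some (w : ℕ)) := by
  have : G.oracle (.randNbr v) = (PMF.uniformOfFinset (G.graph.neighborFinset v)
      (G.neighborFinset_nonempty v)).map fun y => some (y : ℕ) := by
    rw [InputGraph.oracle]
    exact dif_pos v.2
  rw [this]
  erw [PMF.expect_map, PMF.expect_bind, PMF.expect_uniformOfFinset]
  rw [InputGraph.deg, SimpleGraph.card_neighborFinset_eq_degree]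
  congr 1
  exact Finset.sum_congr rfl fun w _ => PMF.expect_pure _ _

theorem expect_oracle_randEdge (G : InputGraph V) (f : Sym2 ℕ → ℝ≥0∞) :
    (G.oracle .randEdge).expect f =
      (2 * G.numEdges : ℝ≥0∞)⁻¹ * G.dartSum fun u v => f s((u : ℕ), (v : ℕ)) := by
  classical
  rw [show G.oracle .randEdge = (PMF.uniformOfFinset G.graph.edgeFinset
    G.edgeFinset_nonempty).map (Sym2.map ((↑) : V → ℕ)) from rfl]
  erw [PMF.expect_map, PMF.expect_uniformOfFinset]
  have hsum := G.sum_edgeFinset_eq_dartSum fun a => f s(a.1, a.2)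
  have hout : ∀ e : Sym2 ℕ, s((Quot.out e).1, (Quot.out e).2) = e := fun e => Quot.out_eq e
  have hout' : ∀ e : Sym2 ℕ, s((Quot.out e).2, (Quot.out e).1) = e := fun e => by
    rw [Sym2.eq_swap, hout]
  simp only [Prod.fst_swap, Prod.snd_swap, hout, hout', ← two_mul, ← Finset.mul_sum] at hsum
  rw [← hsum, ENNReal.mul_inv (by simp) (by simp), mul_comm (2 : ℝ≥0∞)⁻¹, mul_assoc,
    ← mul_assoc (2 : ℝ≥0∞)⁻¹, ENNReal.inv_mul_cancel (by simp) (by simp), one_mul]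
  rfl

end CliqueGraph


/-- Needed because the invariant `Good` is known only for states that occur with positive
probability. -/
theorem PMF.expect_mono_of_support {α : Type*} (p : PMF α) {f g : α → ℝ≥0∞}
    (h : ∀ a ∈ p.support, f a ≤ g a) : p.expect f ≤ p.expect g := by
  refine ENNReal.tsum_le_tsum fun a => ?_
  by_cases ha : a ∈ p.support
  · exact mul_le_mul_right (h a ha) _
  · simp [(p.apply_eq_zero_iff a).2 ha]

/-! ### States of knowledge and ideal answers. -/

/-- What a query algorithm has seen of a clique graph: the set of seen vertices, divided into low
vertices and vertices in cliques, the latter with handles of cliques. -/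
structure SeenState (V : Finset ℕ) where
  seen : Finset V
  handle : V → Option V

namespace SeenState

variable {V : Finset ℕ}

/-- Reveals that a vertex is low, unless it has been seen already. -/
def reveal (σ : SeenState V) (v : V) : SeenState V :=
  if v ∈ σ.seen then σ else ⟨insert v σ.seen, Function.update σ.handle v none⟩

/-- Adds an unseen vertex to a clique. -/
def addClique (σ : SeenState V) (v a : V) : SeenState V :=
  ⟨insert v σ.seen, Function.update σ.handle v (some a)⟩

/-- The hub is seen, it is low, and handles are seen vertices. -/
structure Good (h : V) (σ : SeenState V) : Prop where
  hub_mem : h ∈ σ.seen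
  hub_low : σ.handle h = none
  handle_mem : ∀ x ∈ σ.seen, ∀ a, σ.handle x = some a → a ∈ σ.seen

variable {h : V} {σ : SeenState V}

theorem mem_reveal (σ : SeenState V) (v : V) : v ∈ (σ.reveal v).seen := by
  unfold reveal
  split_ifs with hv
  · exact hv
  · exact Finset.mem_insert_self _ _

theorem seen_subset_reveal (σ : SeenState V) (v : V) : σ.seen ⊆ (σ.reveal v).seen := by
  unfold reveal
  split_ifs
  · exact subset_rfl
  · exact Finset.subset_insert _ _

theorem card_reveal_le (σ : SeenState V) (v : V) :
    (σ.reveal v).seen.card ≤ σ.seen.card + 1 := by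
  unfold reveal
  split_ifs
  · omega
  · exact Finset.card_insert_le _ _

theorem card_addClique_le (σ : SeenState V) (v a : V) :
    (σ.addClique v a).seen.card ≤ σ.seen.card + 1 := Finset.card_insert_le _ _

theorem Good.reveal (hσ : σ.Good h) (v : V) : (σ.reveal v).Good h := by
  unfold SeenState.reveal
  split_ifs with hv
  · exact hσ
  · refine ⟨Finset.mem_insert_of_mem hσ.hub_mem, ?_, fun x hx a ha => ?_⟩
    · dsimp only
      rw [Function.update_of_ne (ne_of_mem_of_not_mem hσ.hub_mem hv), hσ.hub_low]
    · dsimp only at hx ha ⊢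
      rcases eq_or_ne x v with rfl | hxv
      · simp at ha
      · rw [Function.update_of_ne hxv] at ha
        exact Finset.mem_insert_of_mem
          (hσ.handle_mem x (Finset.mem_of_mem_insert_of_ne hx hxv) a ha)

theorem Good.addClique (hσ : σ.Good h) {v a : V} (hv : v ∉ σ.seen) (ha : a ∈ insert v σ.seen) :
    (σ.addClique v a).Good h := by
  unfold SeenState.addClique
  refine ⟨Finset.mem_insert_of_mem hσ.hub_mem, ?_, fun x hx b hb => ?_⟩
  · dsimp only
    rw [Function.update_of_ne (ne_of_mem_of_not_mem hσ.hub_mem hv), hσ.hub_low]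
  · dsimp only at hx hb ⊢
    rcases eq_or_ne x v with rfl | hxv
    · rw [Function.update_self, Option.some.injEq] at hb
      exact hb ▸ ha
    · rw [Function.update_of_ne hxv] at hb
      exact Finset.mem_insert_of_mem
        (hσ.handle_mem x (Finset.mem_of_mem_insert_of_ne hx hxv) b hb)

/-- A uniformly random unseen vertex. -/
def fresh (h : V) (D : Finset V) : PMF V :=
  open scoped Classical in
  if hD : Dᶜ.Nonempty then PMF.uniformOfFinset Dᶜ hD else PMF.pure h

theorem fresh_eq (h : V) {D : Finset V} (hD : Dᶜ.Nonempty) :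
    fresh h D = PMF.uniformOfFinset Dᶜ hD := dif_pos hD

theorem erase_nonempty (hV : 2 ≤ V.card) (h : V) : (Finset.univ.erase h).Nonempty := by
  rw [← Finset.card_pos, Finset.card_erase_of_mem (Finset.mem_univ _), Finset.card_univ,
    Fintype.card_coe]
  omega

/-- A random answer that does not depend on the number of cliques, together with the updated
state. -/
def ideal (hV : 2 ≤ V.card) (h : V) (s : ℕ) (σ : SeenState V) :
    (q : Query) → PMF (q.Answer × SeenState V)
  | .randVert => (PMF.uniformOfFinset Finset.univ ⟨h, Finset.mem_univ h⟩).map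
      fun v : V => ((v : ℕ), σ.reveal v)
  | .degree x => PMF.pure <|
      if hx : x ∈ V then
        (if (⟨x, hx⟩ : V) = h then V.card - 1
          else if (σ.reveal ⟨x, hx⟩).handle ⟨x, hx⟩ = none then (1 : ℕ) else s, σ.reveal ⟨x, hx⟩)
      else ((0 : ℕ), σ)
  | .pair x y => PMF.pure <|
      if hxy : x ∈ V ∧ y ∈ V then
        let u : V := ⟨x, hxy.1⟩
        let v : V := ⟨y, hxy.2⟩
        let σ' := (σ.reveal u).reveal v
        (decide (u ≠ v ∧ (u = h ∨ v = h ∨ (σ'.handle u = σ'.handle v ∧ σ'.handle u ≠ none))), σ')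
      else (false, σ)
  | .randNbr x =>
      if hx : x ∈ V then
        let σ' := σ.reveal ⟨x, hx⟩
        if (⟨x, hx⟩ : V) = h then
          (PMF.uniformOfFinset (Finset.univ.erase h) (erase_nonempty hV h)).map
            fun y : V => (some (y : ℕ), σ'.reveal y)
        else match σ'.handle ⟨x, hx⟩ with
          | none => PMF.pure (some (h : ℕ), σ')
          | some a => (fresh h σ'.seen).map fun y : V => (some (y : ℕ), σ'.addClique y a)
      else PMF.pure (none, σ)
  | .randEdge => (fresh h σ.seen).bind fun u => (fresh h (insert u σ.seen)).map fun v : V =>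
      (s((u : ℕ), (v : ℕ)), (σ.addClique u u).addClique v u)

theorem compl_nonempty {D : Finset V} (hD : D.card < V.card) : Dᶜ.Nonempty := by
  rw [← Finset.card_pos, Finset.card_compl, Fintype.card_coe]
  omega

/-- The invariant kept along an ideal run. Each query shows at most two new vertices, and an unseen
vertex serves as a new handle only when it is being added. -/
theorem good_of_mem_support_ideal (hV : 2 ≤ V.card) (s : ℕ) (hσ : σ.Good h)
    (hcard : σ.seen.card + 1 < V.card) (q : Query) (p : q.Answer × SeenState V)
    (hp : p ∈ (ideal hV h s σ q).support) : p.2.Good h ∧ p.2.seen.card ≤ σ.seen.card + 2 := by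
  cases q with
  | randVert =>
    rw [ideal, PMF.mem_support_map_iff] at hp
    obtain ⟨v, -, rfl⟩ := hp
    exact ⟨hσ.reveal v, (σ.card_reveal_le v).trans (by omega)⟩
  | degree x =>
    rw [ideal, PMF.mem_support_pure_iff] at hp
    subst hp
    by_cases hx : x ∈ V
    · rw [dif_pos hx]
      exact ⟨hσ.reveal _, (σ.card_reveal_le _).trans (by omega)⟩
    · rw [dif_neg hx]
      exact ⟨hσ, Nat.le_add_right _ 2⟩
  | pair x y =>
    rw [ideal, PMF.mem_support_pure_iff] at hp
    subst hp
    split_ifs with hxy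
    · exact ⟨(hσ.reveal _).reveal _, (card_reveal_le _ _).trans
        (Nat.add_le_add_right (card_reveal_le _ _) 1)⟩
    · exact ⟨hσ, Nat.le_add_right _ 2⟩
  | randNbr x =>
    rw [ideal] at hp
    split_ifs at hp with hx hh
    · rw [PMF.mem_support_map_iff] at hp
      obtain ⟨v, -, rfl⟩ := hp
      exact ⟨(hσ.reveal _).reveal _, (card_reveal_le _ _).trans
        (Nat.add_le_add_right (card_reveal_le _ _) 1)⟩
    · have hc := σ.card_reveal_le ⟨x, hx⟩
      dsimp only at hp
      split at hp
      · rw [PMF.mem_support_pure_iff] at hp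
        subst hp
        exact ⟨hσ.reveal _, hc.trans (by omega)⟩
      · rename_i a ha
        rw [PMF.mem_support_map_iff] at hp
        obtain ⟨v, hv, rfl⟩ := hp
        rw [fresh_eq h (compl_nonempty (by omega)), PMF.mem_support_uniformOfFinset_iff,
          Finset.mem_compl] at hv
        exact ⟨(hσ.reveal _).addClique hv (Finset.mem_insert_of_mem
          ((hσ.reveal _).handle_mem _ (mem_reveal _ _) _ ha)),
          (card_addClique_le _ _ _).trans (Nat.add_le_add_right hc 1)⟩
    · rw [PMF.mem_support_pure_iff] at hp
      subst hp
      exact ⟨hσ, Nat.le_add_right _ 2⟩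
  | randEdge =>
    rw [ideal, PMF.mem_support_bind_iff] at hp
    obtain ⟨u, hu, hp⟩ := hp
    rw [PMF.mem_support_map_iff] at hp
    obtain ⟨v, hv, rfl⟩ := hp
    rw [fresh_eq h (compl_nonempty (by omega)), PMF.mem_support_uniformOfFinset_iff,
      Finset.mem_compl] at hu
    rw [fresh_eq h (compl_nonempty (by rw [Finset.card_insert_of_notMem hu]; omega)),
      PMF.mem_support_uniformOfFinset_iff, Finset.mem_compl] at hv
    refine ⟨(hσ.addClique hu (Finset.mem_insert_self _ _)).addClique hv
      (Finset.mem_insert_of_mem (Finset.mem_insert_self _ _)), ?_⟩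
    exact (card_addClique_le _ _ _).trans (Nat.add_le_add_right (card_addClique_le _ _ _) 1)

end SeenState


/-- This replaces a coupling: if the real experiment contains a fraction `c ≥ 1 - δ` of the ideal
one, the ideal expectation exceeds the real one by at most `δ`. -/
theorem ENNReal.le_add_of_mul_le {c X Y δ : ℝ≥0∞} (hc : 1 ≤ c + δ) (hX : X ≤ 1)
    (h : c * X ≤ Y) : X ≤ Y + δ :=
  calc X ≤ (c + δ) * X := le_mul_of_one_le_left zero_le hc
    _ = c * X + δ * X := add_mul _ _ _
    _ ≤ Y + δ := add_le_add h (mul_le_of_le_one_right zero_le hX)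

/-- The error `δ` bounds the probability that a query reveals something unexpected, as long as at
most `R` vertices have been seen. -/
structure CliqueParams (n t s R : ℕ) (δ : ℝ≥0∞) : Prop where
  t_pos : 0 < t
  lt_s : R < s
  lt_n : R + t * s < n
  low : ∀ r ≤ R, 1 ≤ ((n - t * s - r : ℕ) : ℝ≥0∞) * ((n - r : ℕ) : ℝ≥0∞)⁻¹ + δ
  nbr : ∀ r ≤ R, 1 ≤ ((s : ℕ) : ℝ≥0∞)⁻¹ * ((s - r : ℕ) : ℝ≥0∞) + δ
  pair : (t : ℝ≥0∞)⁻¹ ≤ δ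
  edge : ∀ r ≤ R, 1 ≤ ((2 * n + t * s * s - t * s - 2 : ℕ) : ℝ≥0∞)⁻¹ *
    ((t * ((s - r) * (s - (r + 1))) : ℕ) : ℝ≥0∞) + δ

/-! ### One query: ideal answers against the true oracle. -/

namespace SeenState

variable {V : Finset ℕ} {t s R : ℕ} {δ : ℝ≥0∞} {h : V} {σ : SeenState V}

/-- The average over the hidden labelings that are compatible with a state. -/
def avg (t s : ℕ) (σ : SeenState V) (F : (V → Option (Fin t)) → ℝ≥0∞) : ℝ≥0∞ :=
  hiddenAvg t s σ.seen σ.handle F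

theorem avg_le_one {F : (V → Option (Fin t)) → ℝ≥0∞} (hF : ∀ lam, F lam ≤ 1) :
    avg t s σ F ≤ 1 := hiddenAvg_le_one hF

theorem avg_reveal_le (hP : CliqueParams V.card t s R δ)
    (hR : σ.seen.card ≤ R) (v : V) {F : (V → Option (Fin t)) → ℝ≥0∞}
    (hF : ∀ lam, F lam ≤ 1) : avg t s (σ.reveal v) F ≤ avg t s σ F + δ := by
  by_cases hv : v ∈ σ.seen
  · rw [reveal, if_pos hv]
    exact le_self_add
  · have hlow := hP.low _ hR
    rw [← Fintype.card_coe V] at hlow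
    refine ENNReal.le_add_of_mul_le hlow (avg_le_one hF) ?_
    rw [reveal, if_neg hv]
    exact hiddenAvg_insert_low_le hv F

variable {hV : 2 ≤ V.card}

theorem ideal_randVert_le (hP : CliqueParams V.card t s R δ)
    (hR : σ.seen.card ≤ R) (K : ℕ → (V → Option (Fin t)) → ℝ≥0∞)
    (hK : ∀ a lam, K a lam ≤ 1) :
    (ideal hV h s σ .randVert).expect (fun p => avg t s p.2 (K p.1)) ≤
      avg t s σ (fun lam => ((cliqueGraph hV h lam).oracle .randVert).expect fun a => K a lam)
        + δ := by
  rw [ideal]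
  erw [PMF.expect_map]
  have hO : ∀ lam : V → Option (Fin t),
      (((cliqueGraph hV h lam).oracle .randVert).expect fun a => K a lam) =
      (PMF.uniformOfFinset Finset.univ ⟨h, Finset.mem_univ h⟩).expect fun v : V => K v lam := by
    intro lam
    erw [expect_oracle_randVert, PMF.expect_uniformOfFinset]
    simp
  simp only [hO]
  rw [avg, hiddenAvg_expect]
  conv_rhs => rw [← PMF.expect_const (PMF.uniformOfFinset Finset.univ ⟨h, Finset.mem_univ h⟩) δ,
    ← PMF.expect_add]
  exact PMF.expect_mono _ fun v => avg_reveal_le hP hR v (hK v)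

theorem ideal_degree_le (hP : CliqueParams V.card t s R δ)
    (hσ : σ.Good h) (hR : σ.seen.card ≤ R) (x : ℕ)
    (K : ℕ → (V → Option (Fin t)) → ℝ≥0∞) (hK : ∀ a lam, K a lam ≤ 1) :
    (ideal hV h s σ (.degree x)).expect (fun p => avg t s p.2 (K p.1)) ≤
      avg t s σ (fun lam => ((cliqueGraph hV h lam).oracle (.degree x)).expect fun a => K a lam)
        + δ := by
  rw [ideal, PMF.expect_pure]
  by_cases hx : x ∈ V
  · rw [dif_pos hx]
    refine le_trans ?_ (avg_reveal_le hP hR ⟨x, hx⟩ fun lam => PMF.expect_le_one _ fun a => hK a lam)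
    refine hiddenAvg_mono fun lam hsize h1 h2 h3 => le_of_eq ?_
    rw [Fintype.card_coe] at hsize
    have hh : lam h = none := h1 h ((hσ.reveal _).hub_mem) (hσ.reveal _).hub_low
    have hmem := σ.mem_reveal ⟨x, hx⟩
    have hO := (cliqueGraph hV h lam).expect_oracle_degree ⟨x, hx⟩ fun a => K a lam
    refine Eq.trans ?_ hO.symm
    congr 1
    dsimp only
    split_ifs with ha hb
    · rw [ha, deg_hub]
      rfl
    · rw [deg_low ha (h1 _ hmem hb)]
      exact if_pos hb
    · rw [deg_clique hh (h2 _ hmem hb) (by have := hP.lt_s; omega) hsize]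
      exact if_neg hb
  · rw [dif_neg hx]
    refine le_trans (hiddenAvg_mono fun lam _ _ _ _ => le_of_eq ?_) le_self_add
    have : (cliqueGraph hV h lam).oracle (.degree x) = PMF.pure (0 : ℕ) := by
      rw [InputGraph.oracle]
      exact congrArg PMF.pure (dif_neg hx)
    rw [this]
    erw [PMF.expect_pure]

/-- Two errors pay for revealing the endpoints as low, the third for two handles of the same clique.
Only this query compares handles, so collisions are charged per query and not per pair of handles.
-/
theorem ideal_pair_le (hP : CliqueParams V.card t s R δ)
    (hσ : σ.Good h) (hR : σ.seen.card + 1 ≤ R) (x y : ℕ)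
    (K : Bool → (V → Option (Fin t)) → ℝ≥0∞) (hK : ∀ a lam, K a lam ≤ 1) :
    (ideal hV h s σ (.pair x y)).expect (fun p => avg t s p.2 (K p.1)) ≤
      avg t s σ (fun lam => ((cliqueGraph hV h lam).oracle (.pair x y)).expect fun a => K a lam)
        + 3 * δ := by
  classical
  rw [ideal, PMF.expect_pure]
  by_cases hxy : x ∈ V ∧ y ∈ V
  · rw [dif_pos hxy]
    set u : V := ⟨x, hxy.1⟩
    set v : V := ⟨y, hxy.2⟩
    set σ' := (σ.reveal u).reveal v
    have hσ' : σ'.Good h := (hσ.reveal u).reveal v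
    set F : (V → Option (Fin t)) → ℝ≥0∞ := fun lam =>
      ((cliqueGraph hV h lam).oracle (.pair x y)).expect fun a => K a lam
    have hF1 : ∀ lam, F lam ≤ 1 := fun lam => PMF.expect_le_one _ fun a => hK a lam
    have hF : ∀ lam, F lam = K (decide ((cliqueGraph hV h lam).graph.Adj u v)) lam := fun lam =>
      (cliqueGraph hV h lam).expect_oracle_pair u v fun a => K a lam
    have hu : u ∈ σ'.seen := seen_subset_reveal _ _ (mem_reveal _ _)
    have hv : v ∈ σ'.seen := mem_reveal _ _
    have hrev : avg t s σ' F ≤ avg t s σ F + δ + δ :=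
      (avg_reveal_le hP ((card_reveal_le _ _).trans hR) v hF1).trans
        (add_le_add (avg_reveal_le hP (by omega) u hF1) le_rfl)
    suffices hs : avg t s σ' (K (decide (u ≠ v ∧ (u = h ∨ v = h ∨
        (σ'.handle u = σ'.handle v ∧ σ'.handle u ≠ none))))) ≤ avg t s σ' F + δ by
      refine hs.trans ((add_le_add hrev le_rfl).trans (le_of_eq ?_))
      ring
    -- Distinct handles are the only case in which the state does not determine the true answer.
    by_cases hsep : ∃ a b, σ'.handle u = some a ∧ σ'.handle v = some b ∧ a ≠ b
    · obtain ⟨a, b, ha, hb, hab⟩ := hsep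
      have huh : u ≠ h := fun e => by rw [e, hσ'.hub_low] at ha; cases ha
      have hvh : v ≠ h := fun e => by rw [e, hσ'.hub_low] at hb; cases hb
      have hdec : decide (u ≠ v ∧ (u = h ∨ v = h ∨
          (σ'.handle u = σ'.handle v ∧ σ'.handle u ≠ none))) = false := by
        simp [huh, hvh, ha, hb, hab]
      rw [hdec]
      refine (hiddenAvg_le_add_inv hu hv ha hb hab (hK false)).trans (add_le_add ?_ hP.pair)
      refine hiddenAvg_mono fun lam _ _ _ _ => ?_
      split_ifs with hne
      · have : ¬ (cliqueGraph hV h lam).graph.Adj u v := by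
          rw [cliqueGraph_adj]
          tauto
        rw [hF, decide_eq_false this]
      · exact zero_le
    · refine le_trans (hiddenAvg_mono fun lam _ h1 h2 h3 => le_of_eq ?_) le_self_add
      rw [hF]
      congr 1
      rw [decide_eq_decide, cliqueGraph_adj]
      refine and_congr_right fun _ => or_congr_right (or_congr_right ?_)
      constructor
      · rintro ⟨e, hne⟩
        exact ⟨h3 u hu v hv e, h2 u hu hne⟩
      · rintro ⟨e, hne⟩
        have hu' : σ'.handle u ≠ none := fun e' => hne (h1 u hu e')
        have hv' : σ'.handle v ≠ none := fun e' => hne (e.trans (h1 v hv e'))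
        obtain ⟨a, ha⟩ := Option.ne_none_iff_exists'.1 hu'
        obtain ⟨b, hb⟩ := Option.ne_none_iff_exists'.1 hv'
        refine ⟨?_, hu'⟩
        by_contra hne'
        exact hsep ⟨a, b, ha, hb, fun e' => hne' (by rw [ha, hb, e'])⟩
  · rw [dif_neg hxy]
    refine le_trans (hiddenAvg_mono fun lam _ _ _ _ => le_of_eq ?_) le_self_add
    have : (cliqueGraph hV h lam).oracle (.pair x y) = PMF.pure false := by
      rw [InputGraph.oracle]
      refine congrArg PMF.pure (decide_eq_false ?_)
      rintro ⟨hx, hy, -⟩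
      exact hxy ⟨hx, hy⟩
    rw [this]
    erw [PMF.expect_pure]

/-- At a clique vertex, the ideal answer is wrong only when the true neighbor has been seen (the hub
included), which has probability at most about `r / s` with `r` seen vertices. This is why the
cliques must be large. -/
theorem ideal_randNbr_le (hP : CliqueParams V.card t s R δ)
    (hσ : σ.Good h) (hR : σ.seen.card + 1 ≤ R) (x : ℕ)
    (K : Option ℕ → (V → Option (Fin t)) → ℝ≥0∞) (hK : ∀ a lam, K a lam ≤ 1) :
    (ideal hV h s σ (.randNbr x)).expect (fun p => avg t s p.2 (K p.1)) ≤
      avg t s σ (fun lam => ((cliqueGraph hV h lam).oracle (.randNbr x)).expect fun a => K a lam)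
        + 2 * δ := by
  classical
  rw [ideal]
  by_cases hx : x ∈ V
  swap
  · rw [dif_neg hx, PMF.expect_pure]
    refine le_trans (hiddenAvg_mono fun lam _ _ _ _ => le_of_eq ?_) le_self_add
    have : (cliqueGraph hV h lam).oracle (.randNbr x) = PMF.pure none := by
      rw [InputGraph.oracle]
      exact dif_neg hx
    rw [this]
    erw [PMF.expect_pure]
  rw [dif_pos hx]
  set v : V := ⟨x, hx⟩
  set σ' := σ.reveal v
  have hσ' : σ'.Good h := hσ.reveal v
  have hv : v ∈ σ'.seen := mem_reveal _ _
  have hR' : σ'.seen.card ≤ R := (card_reveal_le _ _).trans hR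
  set F : (V → Option (Fin t)) → ℝ≥0∞ := fun lam =>
    ((cliqueGraph hV h lam).oracle (.randNbr x)).expect fun a => K a lam
  have hF1 : ∀ lam, F lam ≤ 1 := fun lam => PMF.expect_le_one _ fun a => hK a lam
  have hF : ∀ lam, F lam = ((cliqueGraph hV h lam).deg v : ℝ≥0∞)⁻¹ *
      ∑ w ∈ (cliqueGraph hV h lam).graph.neighborFinset v, K (some (w : ℕ)) lam := fun lam =>
    expect_oracle_randNbr (cliqueGraph hV h lam) v fun a => K a lam
  have hrev : avg t s σ' F ≤ avg t s σ F + δ := avg_reveal_le hP (by omega) v hF1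
  suffices hs : (if v = h then
      (PMF.uniformOfFinset (Finset.univ.erase h) (erase_nonempty hV h)).map
        fun y : V => (some (y : ℕ), σ'.reveal y)
      else match σ'.handle v with
        | none => PMF.pure (some (h : ℕ), σ')
        | some a => (fresh h σ'.seen).map fun y : V =>
          (some (y : ℕ), σ'.addClique y a)).expect (fun p => avg t s p.2 (K p.1)) ≤
      avg t s σ' F + δ by
    refine hs.trans ((add_le_add hrev le_rfl).trans (le_of_eq ?_))
    ring
  by_cases hvh : v = h
  · rw [if_pos hvh, PMF.expect_map]
    have hF' : F = fun lam => (PMF.uniformOfFinset (Finset.univ.erase h)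
        (erase_nonempty hV h)).expect fun y : V => K (some (y : ℕ)) lam := by
      funext lam
      rw [hF, hvh, PMF.expect_uniformOfFinset, neighborFinset_hub, deg_hub,
        Finset.card_erase_of_mem (Finset.mem_univ _), Finset.card_univ, Fintype.card_coe]
    rw [hF', avg, hiddenAvg_expect]
    conv_rhs => rw [← PMF.expect_const (PMF.uniformOfFinset (Finset.univ.erase h)
      (erase_nonempty hV h)) δ, ← PMF.expect_add]
    exact PMF.expect_mono _ fun y => avg_reveal_le hP hR' y (hK _)
  rw [if_neg hvh]
  rcases hhandle : σ'.handle v with _ | a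
  · dsimp only
    rw [PMF.expect_pure]
    refine le_trans (hiddenAvg_mono fun lam _ h1 _ _ => le_of_eq ?_) le_self_add
    have hlow := h1 v hv hhandle
    rw [hF, deg_low hvh hlow, neighborFinset_low hvh hlow]
    simp
  · dsimp only
    have hcard : σ'.seen.card < V.card := by have := hP.lt_n; omega
    rw [PMF.expect_map, fresh_eq h (compl_nonempty hcard)]
    refine ENNReal.le_add_of_mul_le (hP.nbr _ hR')
      (PMF.expect_le_one _ fun y => avg_le_one (hK _)) ?_
    rw [PMF.expect_uniformOfFinset, Finset.card_compl]
    calc _ = (s : ℝ≥0∞)⁻¹ * ∑ y ∈ σ'.seenᶜ, ((s - σ'.seen.card : ℕ) : ℝ≥0∞) *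
            ((Fintype.card V - σ'.seen.card : ℕ) : ℝ≥0∞)⁻¹ *
            avg t s (σ'.addClique y a) (K (some (y : ℕ))) := by
          rw [← Finset.mul_sum]; ring
      _ ≤ (s : ℝ≥0∞)⁻¹ * ∑ y ∈ σ'.seenᶜ, avg t s σ' (fun lam =>
            if lam y = lam v then K (some (y : ℕ)) lam else 0) := by
          refine mul_le_mul_right (Finset.sum_le_sum fun y hy => ?_) _
          exact hiddenAvg_insert_clique_le hv hhandle (by simpa using hy) _
      _ = avg t s σ' (fun lam => (s : ℝ≥0∞)⁻¹ * ∑ y ∈ σ'.seenᶜ,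
            if lam y = lam v then K (some (y : ℕ)) lam else 0) := by
          simp only [avg, hiddenAvg_const_mul, hiddenAvg_sum]
      -- The unseen members of the clique are some of the true neighbors; the hub and the seen
      -- members are dropped.
      _ ≤ avg t s σ' F := by
          refine hiddenAvg_mono fun lam hsize h1 h2 _ => ?_
          rw [Fintype.card_coe] at hsize
          have hh : lam h = none := h1 h hσ'.hub_mem hσ'.hub_low
          have hlv : lam v ≠ none := h2 v hv (by rw [hhandle]; simp)
          rw [hF, deg_clique hh hlv (by have := hP.lt_s; omega) hsize,
            neighborFinset_clique hh hlv]
          refine mul_le_mul_right ?_ _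
          rw [← Finset.sum_filter]
          refine Finset.sum_le_sum_of_subset fun y hy => ?_
          simp only [Finset.mem_filter, Finset.mem_compl] at hy
          simp only [Finset.mem_insert, Finset.mem_erase, Finset.mem_filter, Finset.mem_univ,
            true_and]
          exact Or.inr ⟨fun e => hy.1 (e ▸ hv), hy.2⟩

/-- Only clique edges between unseen vertices are kept, and `CliqueParams.edge` bounds the loss. The
normalization `2m` is common to all compatible labelings, so it passes through the average. -/
theorem ideal_randEdge_le (hP : CliqueParams V.card t s R δ)
    (hσ : σ.Good h) (hR : σ.seen.card + 1 ≤ R)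
    (K : Sym2 ℕ → (V → Option (Fin t)) → ℝ≥0∞) (hK : ∀ a lam, K a lam ≤ 1) :
    (ideal hV h s σ .randEdge).expect (fun p => avg t s p.2 (K p.1)) ≤
      avg t s σ (fun lam => ((cliqueGraph hV h lam).oracle .randEdge).expect fun a => K a lam)
        + δ := by
  classical
  have hcard : σ.seen.card + 1 < V.card := by have := hP.lt_n; omega
  rw [ideal, PMF.expect_bind]
  simp only [PMF.expect_map]
  refine ENNReal.le_add_of_mul_le (hP.edge _ (by omega : σ.seen.card ≤ R))
    (PMF.expect_le_one _ fun u => PMF.expect_le_one _ fun v => avg_le_one (hK _)) ?_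
  set M : ℕ := 2 * V.card + t * s * s - t * s - 2 with hM
  set r := σ.seen.card
  have hfresh : ∀ G : V → V → ℝ≥0∞, ((fresh h σ.seen).expect fun u =>
      (fresh h (insert u σ.seen)).expect fun v => G u v) =
      ((Fintype.card V - r : ℕ) : ℝ≥0∞)⁻¹ * ∑ u ∈ σ.seenᶜ,
        ((Fintype.card V - (r + 1) : ℕ) : ℝ≥0∞)⁻¹ * ∑ v ∈ (insert u σ.seen)ᶜ, G u v := by
    intro G
    rw [fresh_eq h (compl_nonempty (by omega)), PMF.expect_uniformOfFinset, Finset.card_compl]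
    congr 1
    refine Finset.sum_congr rfl fun u hu => ?_
    have hc : (insert u σ.seen).card = r + 1 :=
      Finset.card_insert_of_notMem (by simpa using hu)
    rw [fresh_eq h (compl_nonempty (by omega)), PMF.expect_uniformOfFinset, Finset.card_compl, hc]
  erw [hfresh]
  calc _ = (M : ℝ≥0∞)⁻¹ * ∑ u ∈ σ.seenᶜ, ∑ v ∈ (insert u σ.seen)ᶜ,
          (t : ℝ≥0∞) * (((s - r : ℕ) : ℝ≥0∞) * ((Fintype.card V - r : ℕ) : ℝ≥0∞)⁻¹ *
          (((s - (r + 1) : ℕ) : ℝ≥0∞) * ((Fintype.card V - (r + 1) : ℕ) : ℝ≥0∞)⁻¹)) *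
          avg t s ((σ.addClique u u).addClique v u) (K s((u : ℕ), (v : ℕ))) := by
        simp only [← Finset.mul_sum]
        push_cast
        ring
    _ ≤ (M : ℝ≥0∞)⁻¹ * ∑ u ∈ σ.seenᶜ, ∑ v ∈ (insert u σ.seen)ᶜ, avg t s σ (fun lam =>
          if lam u = lam v ∧ lam u ≠ none then K s((u : ℕ), (v : ℕ)) lam else 0) := by
        refine mul_le_mul_right (Finset.sum_le_sum fun u hu => Finset.sum_le_sum fun v hv => ?_) _
        have hu' : u ∉ σ.seen := by simpa using hu
        have hc : (insert u σ.seen).card = r + 1 := Finset.card_insert_of_notMem hu'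
        have := hiddenAvg_insert_edge_le (t := t) (s := s) (τ := σ.handle) hu'
          (Finset.mem_compl.1 hv) (fun x hx e => hu' (hσ.handle_mem x hx u e))
          (K s((u : ℕ), (v : ℕ)))
        rw [hc] at this
        exact this
    _ = avg t s σ (fun lam => (M : ℝ≥0∞)⁻¹ * ∑ u ∈ σ.seenᶜ, ∑ v ∈ (insert u σ.seen)ᶜ,
          if lam u = lam v ∧ lam u ≠ none then K s((u : ℕ), (v : ℕ)) lam else 0) := by
        simp only [avg, hiddenAvg_const_mul, hiddenAvg_sum]
    _ ≤ _ := by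
        refine hiddenAvg_mono fun lam hsize h1 h2 _ => ?_
        rw [Fintype.card_coe] at hsize
        have hh : lam h = none := h1 h hσ.hub_mem hσ.hub_low
        have hedges := two_mul_numEdges_cliqueGraph (hV := hV) hh (by have := hP.lt_s; omega)
          (by have := hP.lt_n; omega) hsize
        have hM' : 2 * (cliqueGraph hV h lam).numEdges = M := by omega
        erw [expect_oracle_randEdge]
        rw [show (2 * (cliqueGraph hV h lam).numEdges : ℝ≥0∞) = (M : ℝ≥0∞) by
          rw [← hM']; push_cast; rfl]
        refine mul_le_mul_right ?_ _
        rw [InputGraph.dartSum]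
        refine (Finset.sum_le_sum fun u _ => ?_).trans
          (Finset.sum_le_sum_of_subset (Finset.subset_univ _))
        refine (Finset.sum_le_sum fun v hv => ?_).trans
          (Finset.sum_le_sum_of_subset (Finset.subset_univ _))
        split_ifs with h3 h4
        · exact le_rfl
        · refine absurd ?_ h4
          rw [cliqueGraph_adj]
          refine ⟨?_, Or.inr (Or.inr h3)⟩
          rintro rfl
          simp at hv
        · exact zero_le
        · exact zero_le

theorem ideal_le (hP : CliqueParams V.card t s R δ)
    (hσ : σ.Good h) (hR : σ.seen.card + 2 ≤ R) (q : Query)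
    (K : q.Answer → (V → Option (Fin t)) → ℝ≥0∞) (hK : ∀ a lam, K a lam ≤ 1) :
    (ideal hV h s σ q).expect (fun p => avg t s p.2 (K p.1)) ≤
      avg t s σ (fun lam => ((cliqueGraph hV h lam).oracle q).expect fun a => K a lam)
        + 3 * δ := by
  have h1 : δ ≤ 3 * δ := le_mul_of_one_le_left zero_le (by norm_num)
  have h2 : 2 * δ ≤ 3 * δ := by gcongr; norm_num
  cases q with
  | randVert => exact (ideal_randVert_le hP (by omega) K hK).trans (add_le_add le_rfl h1)
  | degree x => exact (ideal_degree_le hP hσ (by omega) x K hK).trans (add_le_add le_rfl h1)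
  | pair x y => exact ideal_pair_le hP hσ (by omega) x y K hK
  | randNbr x => exact (ideal_randNbr_le hP hσ (by omega) x K hK).trans (add_le_add le_rfl h2)
  | randEdge => exact (ideal_randEdge_le hP hσ (by omega) K hK).trans (add_le_add le_rfl h1)

end SeenState


/-! ### Whole runs with ideal answers. -/

namespace SeenState

variable {V : Finset ℕ} {t s R : ℕ} {δ : ℝ≥0∞} {h : V}

/-- Runs an algorithm with ideal answers. -/
def idealRun (hV : 2 ≤ V.card) (h : V) (s : ℕ) (A : QueryAlgorithm) :
    ℕ → SeenState V → A.State → PMF (Option ℝ)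
  | 0, _, st => (A.step st).bind fun
      | .output r => PMF.pure (some r)
      | .query _ _ => PMF.pure none
  | b + 1, σ, st => (A.step st).bind fun
      | .output r => PMF.pure (some r)
      | .query q next => (ideal hV h s σ q).bind fun p => idealRun hV h s A b p.2 (next p.1)

/-- A run with ideal answers is close to a run on a random clique graph. -/
theorem idealRun_le {hV : 2 ≤ V.card} (hP : CliqueParams V.card t s R δ) (A : QueryAlgorithm)
    {f : Option ℝ → ℝ≥0∞} (hf : ∀ o, f o ≤ 1) (b : ℕ) :
    ∀ (σ : SeenState V) (st : A.State), σ.Good h → σ.seen.card + 2 * b ≤ R →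
      (idealRun hV h s A b σ st).expect f ≤
        avg t s σ (fun lam => (A.run (cliqueGraph hV h lam).oracle b st).expect f) +
          b * (3 * δ) := by
  have hconst : ∀ σ : SeenState V, σ.seen.card ≤ R → ∀ c, avg t s σ (fun _ => c) = c := by
    intro σ hR c
    have h1 := hP.lt_s
    have h2 := hP.lt_n
    exact hiddenAvg_const hP.t_pos (by rw [Fintype.card_coe]; omega) (by omega)
      (by rw [Fintype.card_coe]; omega) c
  induction b with
  | zero =>
    intro σ st hσ hR
    simp only [QueryAlgorithm.run, idealRun]
    rw [hconst σ (by omega)]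
    exact le_self_add
  | succ b ih =>
    intro σ st hσ hR
    rw [idealRun]
    simp only [QueryAlgorithm.run, PMF.expect_bind]
    rw [avg, hiddenAvg_expect]
    conv_rhs => rw [← PMF.expect_const (A.step st) (((b + 1 : ℕ) : ℝ≥0∞) * (3 * δ)),
      ← PMF.expect_add]
    refine PMF.expect_mono _ fun act => ?_
    cases act with
    | output r =>
      dsimp only
      have := hconst σ (by omega) ((PMF.pure (some r)).expect f)
      rw [avg] at this
      rw [this]
      exact le_self_add
    | query q next =>
      simp only [PMF.expect_bind]
      have hcard : σ.seen.card + 1 < V.card := by have := hP.lt_n; omega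
      calc _ ≤ (ideal hV h s σ q).expect (fun p => avg t s p.2 (fun lam =>
            (A.run (cliqueGraph hV h lam).oracle b (next p.1)).expect f) + b * (3 * δ)) := by
            refine PMF.expect_mono_of_support _ fun p hp => ?_
            obtain ⟨h1, h2⟩ := good_of_mem_support_ideal hV s hσ hcard q p hp
            exact ih p.2 (next p.1) h1 (by omega)
        _ ≤ (avg t s σ (fun lam => ((cliqueGraph hV h lam).oracle q).expect fun a =>
              (A.run (cliqueGraph hV h lam).oracle b (next a)).expect f) + 3 * δ) +
              b * (3 * δ) := by
            rw [PMF.expect_add, PMF.expect_const]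
            exact add_le_add (ideal_le hP hσ (by omega) q (fun a lam =>
              (A.run (cliqueGraph hV h lam).oracle b (next a)).expect f)
              fun a lam => PMF.expect_le_one _ hf) le_rfl
        _ = _ := by
            rw [avg]
            push_cast
            ring

/-- The state in which only the hub has been seen. -/
def start (h : V) : SeenState V := ⟨{h}, fun _ => none⟩

theorem good_start (h : V) : (start h).Good h :=
  ⟨Finset.mem_singleton_self h, rfl, fun _ _ _ ha => by cases ha⟩

open scoped Classical in
/-- An algorithm that is accurate on all graphs is accurate with ideal answers. -/
theorem expect_idealRun_le {hV : 2 ≤ V.card} (hP : CliqueParams V.card t s R δ)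
    (A : QueryAlgorithm) (b : ℕ) (hb : 2 * b + 1 ≤ R) {c : ℝ}
    (hA : ∀ G : InputGraph V, 2 / 3 < A.approxProb G b c) {d : ℝ}
    (hd : d = ((2 * V.card + t * s * s - t * s - 2 : ℕ) : ℝ) / V.card) :
    (idealRun hV h s A b (start h) A.init).expect
      (fun o => if ∃ r, o = some r ∧ d / c ≤ r ∧ r ≤ c * d then 0 else 1) ≤
        1 / 3 + b * (3 * δ) := by
  refine (idealRun_le hP A (fun o => by split_ifs <;> simp) b (start h) A.init (good_start h)
    (by simp only [start, Finset.card_singleton]; omega)).trans (add_le_add ?_ le_rfl)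
  refine le_trans (hiddenAvg_mono fun lam hsize h1 _ _ => ?_) (hiddenAvg_const_le (1 / 3))
  rw [Fintype.card_coe] at hsize
  have hh : lam h = none := h1 h (Finset.mem_singleton_self h) rfl
  have hedges := two_mul_numEdges_cliqueGraph (hV := hV) hh (by have := hP.lt_s; omega)
    (by have := hP.lt_n; omega) hsize
  have hM : 2 * V.card + t * s * s - t * s - 2 = 2 * (cliqueGraph hV h lam).numEdges := by omega
  have hd' : (cliqueGraph hV h lam).avgDegree = d := by
    rw [hd, hM, InputGraph.avgDegree]
    push_cast
    rfl
  have hG := hA (cliqueGraph hV h lam)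
  rw [QueryAlgorithm.approxProb, PMF.toOuterMeasure_eq_expect, hd'] at hG
  set p := A.run (cliqueGraph hV h lam).oracle b A.init
  have hsum : p.expect (fun o => if ∃ r, o = some r ∧ d / c ≤ r ∧ r ≤ c * d then 1 else 0) +
      p.expect (fun o => if ∃ r, o = some r ∧ d / c ≤ r ∧ r ≤ c * d then 0 else 1) = 1 := by
    rw [← PMF.expect_add]
    refine Eq.trans ?_ (PMF.expect_const p 1)
    congr 1
    funext o
    split_ifs <;> simp
  by_contra hcon
  push Not at hcon
  have hG' : 2 / 3 <
      p.expect (fun o => if ∃ r, o = some r ∧ d / c ≤ r ∧ r ≤ c * d then 1 else 0) := by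
    convert hG
    exact Iff.rfl
  have hlt := ENNReal.add_lt_add hG' hcon
  have h3 : (2 / 3 + 1 / 3 : ℝ≥0∞) = 1 := by
    rw [← ENNReal.add_div]
    norm_num
    exact ENNReal.div_self (by norm_num) (by norm_num)
  rw [h3] at hlt
  exact absurd hsum hlt.ne'

end SeenState

/-! ### Choice of parameters and the lower bound. -/

theorem one_le_mul_inv_add {x y : ℕ} {δ : ℝ} (hy : 0 < y) (hδ : 0 ≤ δ)
    (h : (y : ℝ) ≤ x + δ * y) : 1 ≤ (x : ℝ≥0∞) * (y : ℝ≥0∞)⁻¹ + ENNReal.ofReal δ := by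
  have hy' : (0 : ℝ) < y := by exact_mod_cast hy
  rw [← div_eq_mul_inv, ← ENNReal.ofReal_natCast x, ← ENNReal.ofReal_natCast y,
    ← ENNReal.ofReal_div_of_pos hy', ← ENNReal.ofReal_add (by positivity) hδ,
    ← ENNReal.ofReal_one]
  apply ENNReal.ofReal_le_ofReal
  rw [← sub_nonneg] at h ⊢
  have : (x : ℝ) / y + δ - 1 = (x + δ * y - y) / y := by field_simp
  rw [this]
  positivity

/-- With `n ≈ k⁴`, `s = k²` and `t ≈ k` all errors are of order `1 / k`: `t s / n` for low vertices,
`k / s` for neighbors, `1 / t` for collisions, and `n / (t s²) + k / s` for edges. -/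
theorem cliqueParams {n k t C : ℕ} (hk4 : k ^ 4 ≤ n) (hn : n ≤ 16 * k ^ 4) (hkt : k ≤ t)
    (htC : t ≤ C * k) (hk : 4 * C + 100 ≤ k) :
    CliqueParams n t (k ^ 2) (2 * k) (ENNReal.ofReal ((2 * C + 76) / k)) := by
  have hk0 : (0 : ℝ) < k := by
    have : 0 < k := by omega
    exact_mod_cast this
  have hkR : (100 : ℝ) ≤ k := by
    have : 100 ≤ k := by omega
    exact_mod_cast this
  have hk4R : (k : ℝ) ^ 4 ≤ n := by exact_mod_cast hk4
  have hnR : (n : ℝ) ≤ 16 * k ^ 4 := by exact_mod_cast hn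
  have hktR : (k : ℝ) ≤ t := by exact_mod_cast hkt
  have htCR : (t : ℝ) ≤ C * k := by exact_mod_cast htC
  have hCk : (4 * C + 100 : ℝ) ≤ k := by exact_mod_cast hk
  have hts : (t : ℝ) * k ^ 2 ≤ C * k ^ 3 := by nlinarith [sq_nonneg (k : ℝ)]
  have hk3 : (0 : ℝ) < (k : ℝ) ^ 3 := by positivity
  have hCk3 : (C : ℝ) * k ^ 3 + 2 * k < k ^ 4 := by
    have h1 : (k : ℝ) ^ 4 = k * k ^ 3 := by ring
    have h2 : (2 : ℝ) * k < 100 * k ^ 3 := by nlinarith [mul_pos hk0 hk0]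
    have h3 : (4 * C + 100 : ℝ) * k ^ 3 ≤ k * k ^ 3 := by gcongr
    have h4 : (0 : ℝ) ≤ C * k ^ 3 := by positivity
    nlinarith
  have hδ : (0 : ℝ) ≤ (2 * C + 76) / k := by positivity
  have hs : 2 * k < k ^ 2 := by nlinarith
  have hlt : 2 * k + t * k ^ 2 < n := by
    have : ((2 * k + t * k ^ 2 : ℕ) : ℝ) < n := by push_cast; linarith
    exact_mod_cast this
  refine ⟨by omega, hs, hlt, fun r hr => ?_, fun r hr => ?_, ?_, fun r hr => ?_⟩
  · refine one_le_mul_inv_add (by omega) hδ ?_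
    rw [Nat.cast_sub (by omega), Nat.cast_sub (by omega), Nat.cast_sub (by omega)]
    have hrR : (r : ℝ) ≤ 2 * k := by exact_mod_cast hr
    have h1 : (k : ℝ) ^ 4 / 2 ≤ n - r := by nlinarith [mul_pos hk0 hk3]
    have h2 : (2 * C + 76 : ℝ) / k * (k ^ 4 / 2) ≤ (2 * C + 76) / k * (n - r) := by gcongr
    have h3 : (2 * C + 76 : ℝ) / k * (k ^ 4 / 2) = (C + 38) * k ^ 3 := by field_simp; ring
    push_cast
    nlinarith
  · rw [mul_comm]
    refine one_le_mul_inv_add (by omega) hδ ?_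
    rw [Nat.cast_sub (by omega)]
    have hrR : (r : ℝ) ≤ 2 * k := by exact_mod_cast hr
    push_cast
    have h3 : (2 * C + 76 : ℝ) / k * k ^ 2 = (2 * C + 76) * k := by field_simp
    have h4 : (0 : ℝ) ≤ C * k := by positivity
    nlinarith
  · have ht0 : (0 : ℝ) < t := by linarith
    rw [← ENNReal.ofReal_natCast, ← ENNReal.ofReal_inv_of_pos ht0]
    apply ENNReal.ofReal_le_ofReal
    calc (t : ℝ)⁻¹ ≤ (k : ℝ)⁻¹ := by gcongr
      _ = 1 / k := (one_div _).symm
      _ ≤ _ := by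
        gcongr
        have : (0 : ℝ) ≤ C := by positivity
        linarith
  · rw [mul_comm]
    have hrR : (r : ℝ) ≤ 2 * k := by exact_mod_cast hr
    have ht0 : (0 : ℝ) < t := by linarith
    have hsub : t * k ^ 2 ≤ t * k ^ 2 * k ^ 2 :=
      Nat.le_mul_of_pos_right _ (Nat.pow_pos (by omega))
    have hle : t * k ^ 2 + 2 ≤ 2 * n + t * k ^ 2 * k ^ 2 := by omega
    have hM : ((2 * n + t * k ^ 2 * k ^ 2 - t * k ^ 2 - 2 : ℕ) : ℝ) =
        2 * n + t * k ^ 2 * k ^ 2 - t * k ^ 2 - 2 := by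
      rw [Nat.cast_sub (by omega), Nat.cast_sub (by omega)]
      push_cast
      ring
    refine one_le_mul_inv_add (by omega) hδ ?_
    rw [hM]
    push_cast
    rw [Nat.cast_sub (by omega), Nat.cast_sub (by omega)]
    push_cast
    have hk2 : (0 : ℝ) < (k : ℝ) ^ 2 := by positivity
    have hn1 : (1 : ℝ) ≤ n := by nlinarith [mul_pos hk0 hk3]
    have hMlow : (t : ℝ) * k ^ 4 / 2 ≤ 2 * n + t * k ^ 2 * k ^ 2 - t * k ^ 2 - 2 := by
      have h1 : (t : ℝ) * k ^ 2 * 2 ≤ t * k ^ 2 * k ^ 2 := by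
        gcongr
        nlinarith
      nlinarith
    have h2 : (2 * C + 76 : ℝ) / k * (t * k ^ 4 / 2) ≤
        (2 * C + 76) / k * (2 * n + t * k ^ 2 * k ^ 2 - t * k ^ 2 - 2) := by gcongr
    -- The allowance must cover `2 n ≤ 32 k⁴ ≤ 32 t k³` and the loss `5 t k³` from seen vertices;
    -- the sum 37 explains the constant 76.
    have h3 : (2 * C + 76 : ℝ) / k * (t * k ^ 4 / 2) = (C + 38) * (t * k ^ 3) := by
      field_simp; ring
    have h4 : (k : ℝ) ^ 4 ≤ t * k ^ 3 := by
      rw [pow_succ' (k : ℝ) 3]; gcongr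
    have h5 : (t : ℝ) * (k ^ 2 * k ^ 2 - (k ^ 2 - r) * (k ^ 2 - (r + 1))) ≤ t * (5 * k ^ 3) := by
      have h6 : (k : ℝ) ^ 2 * k ^ 2 - (k ^ 2 - r) * (k ^ 2 - (r + 1)) ≤ 5 * k ^ 3 := by
        have h7 : (k : ℝ) ^ 2 * k ^ 2 - (k ^ 2 - r) * (k ^ 2 - (r + 1)) =
          k ^ 2 * (2 * r + 1) - r * (r + 1) := by ring
        have h8 : (k : ℝ) ^ 2 * (2 * r + 1) ≤ k ^ 2 * (5 * k) := by
          gcongr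
          linarith
        have h9 : (0 : ℝ) ≤ r * (r + 1) := by positivity
        rw [h7]
        nlinarith
      gcongr
    have h10 : (0 : ℝ) ≤ C * (t * k ^ 3) := by positivity
    have h11 : (0 : ℝ) ≤ t * k ^ 2 := by positivity
    nlinarith

/-- The lower bound. -/
theorem avgDegree_lowerBound (c : ℝ) (hc : 1 ≤ c) :
    ∃ (κ : ℝ) (n₀ : ℕ), 0 < κ ∧
      ∀ n : ℕ, n₀ ≤ n → ∀ V : Finset ℕ, V.card = n →
        ∀ (A : QueryAlgorithm) (b : ℕ),
          (∀ G : InputGraph V, 2 / 3 < A.approxProb G b c) →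
            κ * (n : ℝ) ^ (1 / 4 : ℝ) ≤ b := by
  classical
  -- With `t = k` the degree sum is at most `2 k⁵`, with `t = C k` it is at least `C k⁵ / 2`; hence
  -- `C > 4 c²` separates them by more than `c²`.
  set C : ℕ := ⌈4 * c ^ 2⌉₊ + 1 with hC
  have hCc : 4 * c ^ 2 < C := by
    have := Nat.le_ceil (4 * c ^ 2)
    rw [hC]
    push_cast
    linarith
  set a : ℝ := 2 * C + 76 with ha
  have ha0 : 0 < a := by positivity
  have ha76 : 76 ≤ a := by
    have : (0 : ℝ) ≤ C := by positivity
    linarith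
  -- Since `n^(1/4) ≤ 2 k`, fewer queries than this give `18 a b < k`, so that the error `3 b a / k`
  -- of a run is below `1 / 6`.
  refine ⟨1 / (36 * a), (4 * C + 100) ^ 4, by positivity, ?_⟩
  rintro n hn V rfl A b hA
  by_contra hcon
  push Not at hcon
  set n := V.card with hnV
  set x : ℝ := (n : ℝ) ^ (1 / 4 : ℝ) with hx
  have hx0 : 0 ≤ x := by positivity
  have hx4 : x ^ 4 = n := by
    rw [hx, ← Real.rpow_natCast, ← Real.rpow_mul (by positivity)]
    norm_num
  set k : ℕ := ⌊x⌋₊ with hk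
  have hkx : (k : ℝ) ≤ x := Nat.floor_le hx0
  have hxk : x < k + 1 := Nat.lt_floor_add_one x
  have hk100 : 4 * C + 100 ≤ k := by
    apply Nat.le_floor
    have h1 : ((4 * C + 100 : ℕ) : ℝ) ^ 4 ≤ x ^ 4 := by rw [hx4]; exact_mod_cast hn
    exact le_of_pow_le_pow_left₀ (by norm_num) hx0 h1
  have hkR : (100 : ℝ) ≤ k := by
    have : 100 ≤ k := by omega
    exact_mod_cast this
  have hx2k : x ≤ 2 * k := by linarith
  have hk4R : (k : ℝ) ^ 4 ≤ n := by rw [← hx4]; gcongr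
  have hn16R : (n : ℝ) ≤ 16 * k ^ 4 := by
    rw [← hx4]
    calc x ^ 4 ≤ (2 * k) ^ 4 := by gcongr
      _ = _ := by ring
  have hk4 : k ^ 4 ≤ n := by exact_mod_cast hk4R
  have hn16 : n ≤ 16 * k ^ 4 := by exact_mod_cast hn16R
  have hbk : (b : ℝ) * (18 * a) < k := by
    have h1 : (b : ℝ) < 1 / (36 * a) * (2 * k) := hcon.trans_le (by gcongr)
    have h2 : 1 / (36 * a) * (2 * k) = k / (18 * a) := by field_simp; norm_num
    rw [h2, lt_div_iff₀ (by positivity)] at h1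
    exact h1
  -- The hub and two new vertices per query stay within the bound `2 k` on seen vertices.
  have hbR : 2 * b + 1 ≤ 2 * k := by
    have h1 : (b : ℝ) ≤ b * (18 * a) := le_mul_of_one_le_right (by positivity) (by linarith)
    have : (b : ℝ) < k := by linarith
    have : b < k := by exact_mod_cast this
    omega
  have hC1 : 1 ≤ C := Nat.le_add_left _ _
  have hV2 : 2 ≤ V.card := by
    have : 1 ≤ k ^ 4 := Nat.one_le_pow _ _ (by omega)
    have h2 : 2 ≤ k ^ 4 := (by omega : 2 ≤ k).trans (Nat.le_self_pow (by norm_num) k)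
    omega
  obtain ⟨h⟩ : Nonempty V := by
    obtain ⟨v, hv⟩ := Finset.card_pos.1 (by omega : 0 < V.card)
    exact ⟨⟨v, hv⟩⟩
  have hP₀ := cliqueParams (t := k) hk4 hn16 le_rfl (Nat.le_mul_of_pos_left k hC1) hk100
  have hP₁ := cliqueParams (t := C * k) hk4 hn16 (Nat.le_mul_of_pos_left k hC1) le_rfl hk100
  set M : ℕ → ℕ := fun t => 2 * n + t * k ^ 2 * k ^ 2 - t * k ^ 2 - 2 with hM
  have hMR : ∀ t : ℕ, (M t : ℝ) = 2 * n + t * k ^ 2 * k ^ 2 - t * k ^ 2 - 2 := by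
    intro t
    have hsub : t * k ^ 2 ≤ t * k ^ 2 * k ^ 2 :=
      Nat.le_mul_of_pos_right _ (Nat.pow_pos (by omega))
    rw [hM]
    dsimp only
    rw [Nat.cast_sub (by omega), Nat.cast_sub (by omega)]
    push_cast
    ring
  have hgap : c ^ 2 * (M k : ℝ) < M (C * k) := by
    rw [hMR, hMR]
    have hk0 : (0 : ℝ) < k := by linarith
    have hk5 : (0 : ℝ) < (k : ℝ) ^ 5 := by positivity
    have hc2 : 1 ≤ c ^ 2 := one_le_pow₀ hc
    have e1 : 2 * (n : ℝ) + k * k ^ 2 * k ^ 2 - k * k ^ 2 - 2 ≤ 2 * k ^ 5 := by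
      have h1 : 32 * (k : ℝ) ^ 4 ≤ k ^ 5 := by
        rw [pow_succ' (k : ℝ) 4]; gcongr; linarith
      have h2 : (0 : ℝ) ≤ k * k ^ 2 := by positivity
      nlinarith
    have e2 : (C : ℝ) * k ^ 5 / 2 ≤
        2 * n + ((C * k : ℕ) : ℝ) * k ^ 2 * k ^ 2 - ((C * k : ℕ) : ℝ) * k ^ 2 - 2 := by
      push_cast
      have h1 : (C : ℝ) * k * k ^ 2 * 2 ≤ C * k * k ^ 2 * k ^ 2 := by
        gcongr
        nlinarith
      have h2 : (1 : ℝ) ≤ n := by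
        have : 1 ≤ n := by omega
        exact_mod_cast this
      nlinarith
    have e3 : c ^ 2 * (2 * (n : ℝ) + k * k ^ 2 * k ^ 2 - k * k ^ 2 - 2) ≤ c ^ 2 * (2 * k ^ 5) := by
      gcongr
    nlinarith
  have h₀ := SeenState.expect_idealRun_le (h := h) (hV := hV2) hP₀ A b hbR hA rfl
  have h₁ := SeenState.expect_idealRun_le (h := h) (hV := hV2) hP₁ A b hbR hA rfl
  set p := SeenState.idealRun hV2 h (k ^ 2) A b (SeenState.start h) A.init
  -- The same ideal run serves both values of `t`, and no output is accurate for both, so the two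
  -- failure probabilities sum to at least 1; yet each is below `1 / 3 + 1 / 6`.
  have hone : (1 : ℝ≥0∞) ≤
      (1 / 3 + b * (3 * ENNReal.ofReal (a / k))) + (1 / 3 + b * (3 * ENNReal.ofReal (a / k))) := by
    refine le_trans ?_ (add_le_add h₀ h₁)
    rw [← PMF.expect_add]
    refine (PMF.expect_const p 1).ge.trans (PMF.expect_mono _ fun o => ?_)
    split_ifs with hg₀ hg₁
    · exfalso
      obtain ⟨r, rfl, hr1, hr2⟩ := hg₀
      obtain ⟨r', hr', hr3, hr4⟩ := hg₁
      rw [Option.some.injEq] at hr'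
      subst hr'
      have hn0 : (0 : ℝ) < n := by
        have : 0 < n := by omega
        exact_mod_cast this
      have hlt : (M (C * k) : ℝ) / n / c ≤ c * ((M k : ℝ) / n) := hr3.trans hr2
      rw [div_le_iff₀ (by linarith)] at hlt
      have : (M (C * k) : ℝ) / n ≤ c ^ 2 * M k / n := by
        calc _ ≤ _ := hlt
          _ = _ := by ring
      rw [div_le_div_iff_of_pos_right hn0] at this
      linarith
    · simp
    · simp
    · simp
  have hk0 : (0 : ℝ) < k := by linarith
  have hconv : (1 / 3 + b * (3 * ENNReal.ofReal (a / k)) : ℝ≥0∞) =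
      ENNReal.ofReal (1 / 3 + b * (3 * (a / k))) := by
    rw [ENNReal.ofReal_add (by positivity) (by positivity), ENNReal.ofReal_mul (by positivity),
      ENNReal.ofReal_mul (by positivity), ENNReal.ofReal_natCast,
      ENNReal.ofReal_div_of_pos (show (0 : ℝ) < 3 by norm_num)]
    simp
  rw [hconv, ← ENNReal.ofReal_add (by positivity) (by positivity), ← ENNReal.ofReal_one,
    ENNReal.ofReal_le_ofReal_iff (by positivity)] at hone
  have hlast : (b : ℝ) * (3 * (a / k)) < 1 / 6 := by
    have : (b : ℝ) * (3 * (a / k)) = b * (18 * a) / k / 6 := by ring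
    rw [this]
    have : (b : ℝ) * (18 * a) / k < 1 := (div_lt_one hk0).2 hbk
    linarith
  linarith

end

theorem theorem1p1 :
    -- (a) the algorithm may depend on the number `n` of vertices and on `ε`, but not on the
    -- vertex identifiers or the graph
    (∃ (A : ℕ → ℝ → QueryAlgorithm) (C : ℝ) (k : ℕ), 0 < C ∧
      ∀ (n : ℕ) (ε : ℝ), 0 < ε → ε < 1 →
        ∀ (V : Finset ℕ), V.card = n → ∀ G : InputGraph V,
          99 / 100 < (A n ε).approxProb G
            ⌊C * Real.log n ^ k * (ε ^ 2)⁻¹ *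
              min G.avgDegree ((n / G.avgDegree) ^ (1 / 3 : ℝ))⌋₊ (1 + ε) ∧
          99 / 100 < (A n ε).approxProb G
            ⌊C * Real.log n ^ k * (ε ^ 2)⁻¹ * (n : ℝ) ^ (1 / 4 : ℝ)⌋₊ (1 + ε)) ∧
    -- (b) even if the algorithm depends on the set `V` of vertex identifiers
    (∀ c : ℝ, 1 ≤ c → ∃ (κ : ℝ) (n₀ : ℕ), 0 < κ ∧
      ∀ n : ℕ, n₀ ≤ n → ∀ V : Finset ℕ, V.card = n →
        ∀ (A : QueryAlgorithm) (b : ℕ),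
          (∀ G : InputGraph V, 2 / 3 < A.approxProb G b c) →
            κ * (n : ℝ) ^ (1 / 4 : ℝ) ≤ b) := by
  exact ⟨exists_avgDegree_algorithm, avgDegree_lowerBound⟩
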